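/- **Jacobson radical of the rational double Burnside algebra of $S_3$.** Let $G = S_3$. Let $B(G,G)$ be the double Burnside ring of $G$: the Grothendieck group of finite $(G,G)$-bisets (finite sets with commuting left and right $G$-actions) with respect to disjoint union, with multiplication $[X]\cdot[Y] = [X\times_G Y]$, where $X \times_G Y$ is the set of orbits of $G$ on $X\times Y$ under $(x,y)\cdot g = (xg, g^{-1}y)$. Let $\mathbb{Q}B(G,G) = \mathbb{Q}\otimes_{\mathbb{Z}}B(G,G)$. For a subgroup $L \le G\times G$ let $[G\times G/L]$ be the class of the transitive biset $(G \times G)/L$, with $g\cdot(a,b)L\cdot h = (ga, h^{-1}b)L$. Let $T_1 = 1$, $T_2 = \langle (1\,2)\rangle$, $T_3 = A_3$, $T_4 = S_3$, and define subgroups $L_1,\dots,L_{22}$ of $G \times G$ by $$L_{4(p-1)+q} = T_p \times T_q \quad (1\le p,q\le 4),$$ $$L_{17} = D(T_2,T_2),\quad L_{18} = D(T_2,T_4),\quad L_{19} = D(T_4,T_2),\quad L_{20} = D(T_4,T_4),$$ where $D(P,Q) = \{(a,b)\in P\times Q : \operatorname{sgn} a = \operatorname{sgn} b\}$, and $$L_{21}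 = \{(a,a) : a\in A_3\},\qquad L_{22} = \{(a,a): a\in S_3\}.$$ (These represent the $22$ conjugacy classes of subgroups of $G\times G$.) Then the elements $b_i = [G\times G/L_i]$, $1\le i\le 22$, form a $\mathbb{Q}$-basis of $\mathbb{Q}B(G,G)$, and there is another basis $c_1,\dots,c_{22}$ of $\mathbb{Q}B(G,G)$, uniquely determined by $$\begin{aligned} b_{1} &= 6 c_{1}, \\ b_{2} &= 3 c_{1} + c_{2}, \\ b_{3} &= 2 c_{1} + 2 c_{3}, \\ b_{4} &= c_{1} + c_{2} + c_{3} + c_{4}, \\ b_{5} &= 3 c_{1} + 3 c_{5}, \\ b_{6} &= \tfrac{3}{2} c_{1} + \tfrac{1}{2} c_{2} + \tfrac{3}{2} c_{5} + \tfrac{1}{2} c_{6}, \\ b_{7} &= c_{1} + c_{3} + c_{5} + c_{7}, \\ b_{8} &= \tfrac{1}{2} c_{1} + \tfrac{1}{2} c_{2} + \tfrac{1}{2} c_{3} + \tfrac{1}{2} c_{4} + \tfrac{1}{2} c_{5} + \tfrac{1}{2} c_{6} + \tfrac{1}{2} c_{7} + \tfrac{1}{2} c_{8}, \\ b_{9}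 &= 2 c_{1} + 4 c_{9}, \\ b_{10} &= c_{1} + \tfrac{1}{3} c_{2} + 2 c_{9} + \tfrac{2}{3} c_{10}, \\ b_{11} &= \tfrac{2}{3} c_{1} + \tfrac{2}{3} c_{3} + \tfrac{4}{3} c_{9} + \tfrac{4}{3} c_{11}, \\ b_{12} &= \tfrac{1}{3} c_{1} + \tfrac{1}{3} c_{2} + \tfrac{1}{3} c_{3} + \tfrac{1}{3} c_{4} + \tfrac{2}{3} c_{9} + \tfrac{2}{3} c_{10} + \tfrac{2}{3} c_{11} + \tfrac{2}{3} c_{12}, \\ b_{13} &= c_{1} + 3 c_{5} + 2 c_{9} + 6 c_{13}, \\ b_{14} &= \tfrac{1}{2} c_{1} + \tfrac{1}{6} c_{2} + \tfrac{3}{2} c_{5} + \tfrac{1}{2} c_{6} + c_{9} + \tfrac{1}{3} c_{10} + 3 c_{13} + c_{14}, \\ b_{15} &= \tfrac{1}{3} c_{1} + \tfrac{1}{3} c_{3} + c_{5} + c_{7} + \tfrac{2}{3} c_{9} + \tfrac{2}{3} c_{11} + 2 c_{13} + 2 c_{15}, \\ b_{16} &= \tfrac{1}{6} c_{1} + \tfrac{1}{6}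 c_{2} + \tfrac{1}{6} c_{3} + \tfrac{1}{6} c_{4} + \tfrac{1}{2} c_{5} + \tfrac{1}{2} c_{6} + \tfrac{1}{2} c_{7} + \tfrac{1}{2} c_{8} + \tfrac{1}{3} c_{9} + \tfrac{1}{3} c_{10} + \tfrac{1}{3} c_{11} + \tfrac{1}{3} c_{12} + c_{13} + c_{14} + c_{15} + c_{16}, \\ b_{17} &= 3 c_{1} + c_{6} + c_{17}, \\ b_{18} &= c_{1} + c_{3} + c_{6} + c_{8} + c_{17} + c_{18}, \\ b_{19} &= c_{1} + c_{6} + 2 c_{9} + 2 c_{14} + c_{17} + 2 c_{19}, \\ b_{20} &= \tfrac{1}{3} c_{1} + \tfrac{1}{3} c_{3} + c_{6} + c_{8} + \tfrac{2}{3} c_{9} + \tfrac{2}{3} c_{11} + 2 c_{14} + 2 c_{16} + c_{17} + c_{18} + 2 c_{19} + 2 c_{20}, \\ b_{21} &= 2 c_{1} + 2 c_{11} + 2 c_{21}, \\ b_{22} &= c_{1} + c_{6} + c_{11} + c_{17} + c_{21} + c_{22}. \end{aligned}$$ Let $J$ be the Jacobson radical of $\mathbb{Q}B(G,G)$. Then: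 1. $\{c_i : i = 4,8,12,13,14,15,16,18,19,20\}$ is a $\mathbb{Q}$-basis of $J$. 2. $\mathbb{Q}B(G,G)/J \cong \mathbb{Q}^{3\times 3}\oplus\mathbb{Q}\oplus\mathbb{Q}\oplus\mathbb{Q}$ as $\mathbb{Q}$-algebras. -/

import Mathlib

open scoped TensorProduct MulOpposite

/-! ### Finite bisets and their isomorphism classes -/

/-- A finite `(G, H)`-biset: a finite set with a left action of `G` and a right action of `H`
(encoded as an action of `Hᵐᵒᵖ`, so that `x · h` is `MulOpposite.op h • x`) which commute. -/
structure FinBiset (G H : Type) [Group G] [Group H] : Type 1 where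
  carrier : Type
  [fin : Finite carrier]
  [left : MulAction G carrier]
  [right : MulAction Hᵐᵒᵖ carrier]
  [comm : SMulCommClass G Hᵐᵒᵖ carrier]

attribute [instance] FinBiset.fin FinBiset.left FinBiset.right FinBiset.comm

/-- Two bisets are isomorphic if there is a bijection compatible with both actions. -/
def FinBiset.Iso {G H : Type} [Group G] [Group H] (X Y : FinBiset G H) : Prop :=
  ∃ e : X.carrier ≃ Y.carrier,
    (∀ (g : G) (x : X.carrier), e (g • x) = g • e x) ∧
    (∀ (h : Hᵐᵒᵖ) (x : X.carrier), e (h • x) = h • e x)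

instance FinBiset.setoid (G H : Type) [Group G] [Group H] : Setoid (FinBiset G H) where
  r := FinBiset.Iso
  iseqv :=
    { refl := fun _ => ⟨Equiv.refl _, fun _ _ => rfl, fun _ _ => rfl⟩
      symm := by
        rintro X Y ⟨e, h1, h2⟩
        exact ⟨e.symm, fun g y => by rw [Equiv.symm_apply_eq, h1, Equiv.apply_symm_apply],
          fun g y => by rw [Equiv.symm_apply_eq, h2, Equiv.apply_symm_apply]⟩
      trans := by
        rintro X Y Z ⟨e, h1, h2⟩ ⟨f, k1, k2⟩
        exact ⟨e.trans f, fun g x => by simp [h1, k1], fun g x => by simp [h2, k2]⟩ }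

/-- Isomorphism classes of finite `(G, H)`-bisets. -/
def BisetClass (G H : Type) [Group G] [Group H] : Type 1 :=
  Quotient (FinBiset.setoid G H)

/-- The isomorphism class of a finite biset. -/
def BisetClass.mk {G H : Type} [Group G] [Group H] (X : FinBiset G H) : BisetClass G H :=
  Quotient.mk _ X

/-- Disjoint union of bisets. -/
def FinBiset.sum {G H : Type} [Group G] [Group H] (X Y : FinBiset G H) : FinBiset G H where
  carrier := X.carrier ⊕ Y.carrier

/-- The empty biset. -/
def FinBiset.empty (G H : Type) [Group G] [Group H] : FinBiset G H where
  carrier := Empty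
  left := { smul := fun _ x => x, one_smul := fun _ => rfl, mul_smul := fun _ _ _ => rfl }
  right := { smul := fun _ x => x, one_smul := fun _ => rfl, mul_smul := fun _ _ _ => rfl }
  comm := by
    refine @SMulCommClass.mk _ _ _ (_) (_) ?_
    intro _ _ x
    exact x.elim

instance BisetClass.instAdd (G H : Type) [Group G] [Group H] : Add (BisetClass G H) where
  add := Quotient.map₂ FinBiset.sum (by
    rintro X X' ⟨e, h1, h2⟩ Y Y' ⟨f, k1, k2⟩
    refine ⟨Equiv.sumCongr e f, ?_, ?_⟩
    · rintro g (x | x)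
      · exact congrArg Sum.inl (h1 g x)
      · exact congrArg Sum.inr (k1 g x)
    · rintro g (x | x)
      · exact congrArg Sum.inl (h2 g x)
      · exact congrArg Sum.inr (k2 g x))

instance BisetClass.instZero (G H : Type) [Group G] [Group H] : Zero (BisetClass G H) where
  zero := BisetClass.mk (FinBiset.empty G H)

/-- Isomorphism classes of bisets form a commutative monoid under disjoint union. -/
instance BisetClass.addCommMonoid (G H : Type) [Group G] [Group H] :
    AddCommMonoid (BisetClass G H) where
  add_assoc := by
    rintro ⟨X⟩ ⟨Y⟩ ⟨Z⟩
    refine Quotient.sound ⟨Equiv.sumAssoc _ _ _, ?_, ?_⟩ <;>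
    · rintro g ((x | x) | x) <;> rfl
  zero_add := by
    rintro ⟨X⟩
    refine Quotient.sound ⟨Equiv.emptySum Empty _, ?_, ?_⟩ <;>
    · rintro g (x | x)
      · exact x.elim
      · rfl
  add_zero := by
    rintro ⟨X⟩
    refine Quotient.sound ⟨Equiv.sumEmpty _ Empty, ?_, ?_⟩ <;>
    · rintro g (x | x)
      · rfl
      · exact x.elim
  add_comm := by
    rintro ⟨X⟩ ⟨Y⟩
    refine Quotient.sound ⟨Equiv.sumComm _ _, ?_, ?_⟩ <;>
    · rintro g (x | x) <;> rfl
  nsmul := nsmulRec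

/-! ### The tensor product of bisets -/

/-- The orbit relation of `H` on `X × Y` for the action `(x, y) · h = (x · h, h⁻¹ · y)`. -/
def tensorSetoid {G H K : Type} [Group G] [Group H] [Group K]
    (X : FinBiset G H) (Y : FinBiset H K) : Setoid (X.carrier × Y.carrier) where
  r p q := ∃ h : H, q = (MulOpposite.op h • p.1, h⁻¹ • p.2)
  iseqv :=
    { refl := fun p => ⟨1, by simp⟩
      symm := by
        rintro p q ⟨h, rfl⟩
        exact ⟨h⁻¹, by simp⟩
      trans := by
        rintro p q r ⟨h, rfl⟩ ⟨k, rfl⟩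
        exact ⟨h * k, by simp [mul_smul]⟩ }

/-- The tensor product `X ×_H Y` of a `(G, H)`-biset and an `(H, K)`-biset. -/
def FinBiset.tensor {G H K : Type} [Group G] [Group H] [Group K]
    (X : FinBiset G H) (Y : FinBiset H K) : FinBiset G K where
  carrier := Quotient (tensorSetoid X Y)
  left :=
    { smul := fun g => Quotient.map (fun p => (g • p.1, p.2)) (by
        rintro p q ⟨h, rfl⟩
        exact ⟨h, by simp [smul_comm]⟩)
      one_smul := by
        rintro ⟨p⟩
        exact congrArg (Quotient.mk (tensorSetoid X Y)) (by simp)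
      mul_smul := by
        rintro g g' ⟨p⟩
        exact congrArg (Quotient.mk (tensorSetoid X Y)) (by simp [mul_smul]) }
  right :=
    { smul := fun k => Quotient.map (fun p => (p.1, k • p.2)) (by
        rintro p q ⟨h, rfl⟩
        exact ⟨h, by simp [smul_comm]⟩)
      one_smul := by
        rintro ⟨p⟩
        exact congrArg (Quotient.mk (tensorSetoid X Y)) (by simp)
      mul_smul := by
        rintro g g' ⟨p⟩
        exact congrArg (Quotient.mk (tensorSetoid X Y)) (by simp [mul_smul]) }
  comm := by
    refine @SMulCommClass.mk _ _ _ (_) (_) ?_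
    rintro g k ⟨p⟩
    rfl

/-- The regular `(G, G)`-biset `G`. -/
def FinBiset.regular (G : Type) [Group G] [Finite G] : FinBiset G G where
  carrier := G

/-- The product of isomorphism classes induced by the tensor product of bisets. -/
def BisetClass.tensor {G H K : Type} [Group G] [Group H] [Group K] :
    BisetClass G H → BisetClass H K → BisetClass G K :=
  Quotient.map₂ FinBiset.tensor (by
    rintro X X' ⟨e, h1, h2⟩ Y Y' ⟨f, k1, k2⟩
    refine ⟨Quotient.congr (Equiv.prodCongr e f) ?_, ?_, ?_⟩
    · rintro ⟨x, y⟩ ⟨x', y'⟩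
      constructor
      · rintro ⟨h, hh⟩
        obtain ⟨rfl, rfl⟩ := Prod.mk.inj hh
        exact ⟨h, Prod.ext (h2 _ _) (k1 _ _)⟩
      · rintro ⟨h, hh⟩
        obtain ⟨ha, hb⟩ := Prod.mk.inj hh
        exact ⟨h, Prod.ext (e.injective (ha.trans (h2 _ _).symm))
          (f.injective (hb.trans (k1 _ _).symm))⟩
    · rintro g ⟨x, y⟩
      exact congrArg (Quotient.mk (tensorSetoid X' Y')) (Prod.ext (h1 g x) rfl)
    · rintro g ⟨x, y⟩
      exact congrArg (Quotient.mk (tensorSetoid X' Y')) (Prod.ext rfl (k2 g y)))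

theorem BisetClass.zero_tensor {G H K : Type} [Group G] [Group H] [Group K]
    (Y : BisetClass H K) : BisetClass.tensor (0 : BisetClass G H) Y = 0 := by
  obtain ⟨Y⟩ := Y
  refine Quotient.sound ⟨⟨fun q => q.lift (fun p => p.1) (fun p => p.1.elim), fun x => x.elim, ?_,
    fun x => x.elim⟩, ?_, ?_⟩
  · rintro ⟨p⟩
    exact p.1.elim
  · rintro g ⟨p⟩
    exact p.1.elim
  · rintro g ⟨p⟩
    exact p.1.elim

theorem BisetClass.tensor_zero {G H K : Type} [Group G] [Group H] [Group K]
    (X : BisetClass G H) : BisetClass.tensor X (0 : BisetClass H K) = 0 := by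
  obtain ⟨X⟩ := X
  refine Quotient.sound ⟨⟨fun q => q.lift (fun p => p.2) (fun p => p.2.elim), fun x => x.elim, ?_,
    fun x => x.elim⟩, ?_, ?_⟩
  · rintro ⟨p⟩
    exact p.2.elim
  · rintro g ⟨p⟩
    exact p.2.elim
  · rintro g ⟨p⟩
    exact p.2.elim

theorem BisetClass.add_tensor {G H K : Type} [Group G] [Group H] [Group K]
    (X X' : BisetClass G H) (Y : BisetClass H K) :
    BisetClass.tensor (X + X') Y = BisetClass.tensor X Y + BisetClass.tensor X' Y := by
  obtain ⟨X⟩ := X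
  obtain ⟨X'⟩ := X'
  obtain ⟨Y⟩ := Y
  refine Quotient.sound ⟨⟨fun q => q.lift
      (fun p => p.1.elim (fun x => Sum.inl (Quotient.mk (tensorSetoid X Y) (x, p.2)))
        (fun x => Sum.inr (Quotient.mk (tensorSetoid X' Y) (x, p.2)))) ?_,
    Sum.elim
      (fun q => q.lift
        (fun p => Quotient.mk (tensorSetoid (X.sum X') Y) (Sum.inl p.1, p.2)) ?_)
      (fun q => q.lift
        (fun p => Quotient.mk (tensorSetoid (X.sum X') Y) (Sum.inr p.1, p.2)) ?_), ?_, ?_⟩, ?_, ?_⟩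
  · rintro ⟨x | x, y⟩ ⟨x', y'⟩ ⟨h, hh⟩ <;> obtain ⟨rfl, rfl⟩ := Prod.mk.inj hh
    · exact congrArg Sum.inl (Quotient.sound ⟨h, rfl⟩)
    · exact congrArg Sum.inr (Quotient.sound ⟨h, rfl⟩)
  · rintro ⟨x, y⟩ ⟨x', y'⟩ ⟨h, hh⟩
    obtain ⟨rfl, rfl⟩ := Prod.mk.inj hh
    exact Quotient.sound ⟨h, rfl⟩
  · rintro ⟨x, y⟩ ⟨x', y'⟩ ⟨h, hh⟩
    obtain ⟨rfl, rfl⟩ := Prod.mk.inj hh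
    exact Quotient.sound ⟨h, rfl⟩
  · rintro ⟨x | x, y⟩ <;> rfl
  · rintro (⟨x, y⟩ | ⟨x, y⟩) <;> rfl
  · rintro g ⟨x | x, y⟩ <;> rfl
  · rintro g ⟨x | x, y⟩ <;> rfl

theorem BisetClass.tensor_add {G H K : Type} [Group G] [Group H] [Group K]
    (X : BisetClass G H) (Y Y' : BisetClass H K) :
    BisetClass.tensor X (Y + Y') = BisetClass.tensor X Y + BisetClass.tensor X Y' := by
  obtain ⟨X⟩ := X
  obtain ⟨Y⟩ := Y
  obtain ⟨Y'⟩ := Y'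
  refine Quotient.sound ⟨⟨fun q => q.lift
      (fun p => p.2.elim (fun y => Sum.inl (Quotient.mk (tensorSetoid X Y) (p.1, y)))
        (fun y => Sum.inr (Quotient.mk (tensorSetoid X Y') (p.1, y)))) ?_,
    Sum.elim
      (fun q => q.lift
        (fun p => Quotient.mk (tensorSetoid X (Y.sum Y')) (p.1, Sum.inl p.2)) ?_)
      (fun q => q.lift
        (fun p => Quotient.mk (tensorSetoid X (Y.sum Y')) (p.1, Sum.inr p.2)) ?_), ?_, ?_⟩, ?_, ?_⟩
  · rintro ⟨x, y | y⟩ ⟨x', y'⟩ ⟨h, hh⟩ <;> obtain ⟨rfl, rfl⟩ := Prod.mk.inj hh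
    · exact congrArg Sum.inl (Quotient.sound ⟨h, rfl⟩)
    · exact congrArg Sum.inr (Quotient.sound ⟨h, rfl⟩)
  · rintro ⟨x, y⟩ ⟨x', y'⟩ ⟨h, hh⟩
    obtain ⟨rfl, rfl⟩ := Prod.mk.inj hh
    exact Quotient.sound ⟨h, rfl⟩
  · rintro ⟨x, y⟩ ⟨x', y'⟩ ⟨h, hh⟩
    obtain ⟨rfl, rfl⟩ := Prod.mk.inj hh
    exact Quotient.sound ⟨h, rfl⟩
  · rintro ⟨x, y | y⟩ <;> rfl
  · rintro (⟨x, y⟩ | ⟨x, y⟩) <;> rfl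
  · rintro g ⟨x, y | y⟩ <;> rfl
  · rintro g ⟨x, y | y⟩ <;> rfl

theorem BisetClass.tensor_assoc {G H K M : Type} [Group G] [Group H] [Group K] [Group M]
    (X : BisetClass G H) (Y : BisetClass H K) (Z : BisetClass K M) :
    BisetClass.tensor (BisetClass.tensor X Y) Z =
      BisetClass.tensor X (BisetClass.tensor Y Z) := by
  obtain ⟨X⟩ := X
  obtain ⟨Y⟩ := Y
  obtain ⟨Z⟩ := Z
  let f : ((X.tensor Y).tensor Z).carrier → (X.tensor (Y.tensor Z)).carrier :=
    Quotient.lift (s := tensorSetoid (X.tensor Y) Z)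
      (fun p => Quotient.lift (s := tensorSetoid X Y)
        (fun r => Quotient.mk (tensorSetoid X (Y.tensor Z))
          (r.1, Quotient.mk (tensorSetoid Y Z) (r.2, p.2)))
        (by
          rintro ⟨x, y⟩ ⟨x', y'⟩ ⟨h, hh⟩
          obtain ⟨rfl, rfl⟩ := Prod.mk.inj hh
          exact Quotient.sound ⟨h, rfl⟩) p.1)
      (by
        rintro ⟨⟨x, y⟩, z⟩ ⟨q, z'⟩ ⟨k, hh⟩
        obtain ⟨rfl, rfl⟩ := Prod.mk.inj hh
        exact congrArg (fun w => Quotient.mk (tensorSetoid X (Y.tensor Z)) (x, w))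
          (Quotient.sound ⟨k, rfl⟩))
  let f' : (X.tensor (Y.tensor Z)).carrier → ((X.tensor Y).tensor Z).carrier :=
    Quotient.lift (s := tensorSetoid X (Y.tensor Z))
      (fun p => Quotient.lift (s := tensorSetoid Y Z)
        (fun r => Quotient.mk (tensorSetoid (X.tensor Y) Z)
          (Quotient.mk (tensorSetoid X Y) (p.1, r.1), r.2))
        (by
          rintro ⟨y, z⟩ ⟨y', z'⟩ ⟨k, hh⟩
          obtain ⟨rfl, rfl⟩ := Prod.mk.inj hh
          exact Quotient.sound ⟨k, rfl⟩) p.2)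
      (by
        rintro ⟨x, ⟨y, z⟩⟩ ⟨x', q⟩ ⟨h, hh⟩
        obtain ⟨rfl, rfl⟩ := Prod.mk.inj hh
        exact congrArg (fun w => Quotient.mk (tensorSetoid (X.tensor Y) Z) (w, z))
          (Quotient.sound ⟨h, rfl⟩))
  refine Quotient.sound ⟨⟨f, f', ?_, ?_⟩, ?_, ?_⟩
  · rintro ⟨⟨⟨x, y⟩, z⟩⟩
    rfl
  · rintro ⟨⟨x, ⟨y, z⟩⟩⟩
    rfl
  · rintro g ⟨⟨⟨x, y⟩, z⟩⟩
    rfl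
  · rintro g ⟨⟨⟨x, y⟩, z⟩⟩
    rfl

theorem BisetClass.one_tensor {G H : Type} [Group G] [Group H] [Finite G]
    (X : BisetClass G H) :
    BisetClass.tensor (BisetClass.mk (FinBiset.regular G)) X = X := by
  obtain ⟨X⟩ := X
  refine Quotient.sound ⟨⟨fun q => q.lift (fun p => (p.1 : G) • p.2) ?_,
    fun x => Quotient.mk (tensorSetoid (FinBiset.regular G) X) ((1 : G), x), ?_, ?_⟩, ?_, ?_⟩
  · rintro ⟨(a : G), x⟩ ⟨(b : G), y⟩ ⟨h, hh⟩
    obtain ⟨rfl, rfl⟩ := Prod.mk.inj hh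
    change a • x = (a * h) • h⁻¹ • x
    rw [smul_smul, mul_inv_cancel_right]
  · rintro ⟨(a : G), x⟩
    refine Quotient.sound ⟨a, Prod.ext ?_ ?_⟩
    · exact (one_mul a).symm
    · exact (inv_smul_smul a x).symm
  · intro x
    exact one_smul G x
  · rintro g ⟨(a : G), x⟩
    exact mul_smul g a x
  · rintro h ⟨(a : G), x⟩
    exact smul_comm a h x

theorem BisetClass.tensor_one {G H : Type} [Group G] [Group H] [Finite H]
    (X : BisetClass G H) :
    BisetClass.tensor X (BisetClass.mk (FinBiset.regular H)) = X := by
  obtain ⟨X⟩ := X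
  refine Quotient.sound ⟨⟨fun q => q.lift (fun p => MulOpposite.op (p.2 : H) • p.1) ?_,
    fun x => Quotient.mk (tensorSetoid X (FinBiset.regular H)) (x, (1 : H)), ?_, ?_⟩, ?_, ?_⟩
  · rintro ⟨x, (a : H)⟩ ⟨y, (b : H)⟩ ⟨h, hh⟩
    obtain ⟨rfl, rfl⟩ := Prod.mk.inj hh
    change MulOpposite.op a • x = MulOpposite.op (h⁻¹ * a) • MulOpposite.op h • x
    rw [smul_smul, ← MulOpposite.op_mul, mul_inv_cancel_left]
  · rintro ⟨x, (a : H)⟩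
    refine Quotient.sound ⟨a⁻¹, Prod.ext ?_ ?_⟩
    · change x = MulOpposite.op a⁻¹ • MulOpposite.op a • x
      rw [smul_smul, ← MulOpposite.op_mul, mul_inv_cancel, MulOpposite.op_one, one_smul]
    · change a = a⁻¹⁻¹ * 1
      simp
  · intro x
    exact one_smul _ x
  · rintro g ⟨x, (a : H)⟩
    exact (smul_comm g (MulOpposite.op a) x).symm
  · rintro h ⟨x, (a : H)⟩
    change MulOpposite.op (a * h.unop) • x = h • MulOpposite.op a • x
    rw [smul_smul, MulOpposite.op_mul, MulOpposite.op_unop]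

/-! ### The double Burnside ring -/

/-- `B(G, H)`: the Grothendieck group of finite `(G, H)`-bisets, under disjoint union. -/
def DoubleBurnside (G H : Type) [Group G] [Group H] : Type 1 :=
  Algebra.GrothendieckAddGroup (BisetClass G H)

noncomputable instance DoubleBurnside.addCommGroup (G H : Type) [Group G] [Group H] :
    AddCommGroup (DoubleBurnside G H) :=
  inferInstanceAs (AddCommGroup (Algebra.GrothendieckAddGroup (BisetClass G H)))

/-- The element of `B(G, H)` given by an isomorphism class of bisets. -/
noncomputable def DoubleBurnside.of {G H : Type} [Group G] [Group H] :
    BisetClass G H →+ DoubleBurnside G H :=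
  Algebra.GrothendieckAddGroup.of

/-- The universal property of the Grothendieck group. -/
noncomputable def DoubleBurnside.lift {G H : Type} [Group G] [Group H] {A : Type*}
    [AddCommGroup A] : (BisetClass G H →+ A) ≃ (DoubleBurnside G H →+ A) :=
  Algebra.GrothendieckAddGroup.lift

theorem DoubleBurnside.lift_of {G H : Type} [Group G] [Group H] {A : Type*}
    [AddCommGroup A] (f : BisetClass G H →+ A) (x : BisetClass G H) :
    DoubleBurnside.lift f (DoubleBurnside.of x) = f x :=
  DFunLike.congr_fun (DoubleBurnside.lift.symm_apply_apply f) x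

theorem DoubleBurnside.hom_ext {G H : Type} [Group G] [Group H] {A : Type*}
    [AddCommGroup A] {f g : DoubleBurnside G H →+ A}
    (h : ∀ x, f (DoubleBurnside.of x) = g (DoubleBurnside.of x)) : f = g :=
  DoubleBurnside.lift.symm.injective (AddMonoidHom.ext h)

/-- The bi-additive map `B(G, H) × B(H, K) → B(G, K)`, `([X], [Y]) ↦ [X ×_H Y]`. -/
noncomputable def DoubleBurnside.tensor (G H K : Type) [Group G] [Group H] [Group K] :
    DoubleBurnside G H →+ DoubleBurnside H K →+ DoubleBurnside G K :=
  DoubleBurnside.lift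
    { toFun := fun X => DoubleBurnside.lift
        { toFun := fun Y => DoubleBurnside.of (BisetClass.tensor X Y)
          map_zero' := by rw [BisetClass.tensor_zero, map_zero]
          map_add' := fun Y Y' => by rw [BisetClass.tensor_add, map_add] }
      map_zero' := DoubleBurnside.hom_ext fun Y => by
        rw [DoubleBurnside.lift_of]
        change DoubleBurnside.of (BisetClass.tensor 0 Y) = 0
        rw [BisetClass.zero_tensor, map_zero]
      map_add' := fun X X' => DoubleBurnside.hom_ext fun Y => by
        rw [AddMonoidHom.add_apply]
        simp only [DoubleBurnside.lift_of]
        change DoubleBurnside.of (BisetClass.tensor (X + X') Y) =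
          DoubleBurnside.of (BisetClass.tensor X Y) + DoubleBurnside.of (BisetClass.tensor X' Y)
        rw [BisetClass.add_tensor, map_add] }

theorem DoubleBurnside.tensor_of {G H K : Type} [Group G] [Group H] [Group K]
    (X : BisetClass G H) (Y : BisetClass H K) :
    DoubleBurnside.tensor G H K (DoubleBurnside.of X) (DoubleBurnside.of Y) =
      DoubleBurnside.of (BisetClass.tensor X Y) := by
  unfold DoubleBurnside.tensor
  rw [DoubleBurnside.lift_of]
  exact DoubleBurnside.lift_of _ _

theorem DoubleBurnside.tensor_assoc {G H K M : Type} [Group G] [Group H] [Group K] [Group M]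
    (x : DoubleBurnside G H) (y : DoubleBurnside H K) (z : DoubleBurnside K M) :
    DoubleBurnside.tensor G K M (DoubleBurnside.tensor G H K x y) z =
      DoubleBurnside.tensor G H M x (DoubleBurnside.tensor H K M y z) := by
  have key : (AddMonoidHom.compHom (DoubleBurnside.tensor G K M)).comp
        (DoubleBurnside.tensor G H K) =
      ((AddMonoidHom.compHom.flip (DoubleBurnside.tensor H K M)).comp
        (AddMonoidHom.compHom.comp (DoubleBurnside.tensor G H M))) := by
    refine DoubleBurnside.hom_ext fun X => DoubleBurnside.hom_ext fun Y =>
      DoubleBurnside.hom_ext fun Z => ?_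
    change DoubleBurnside.tensor G K M (DoubleBurnside.tensor G H K _ _) _ =
      DoubleBurnside.tensor G H M _ (DoubleBurnside.tensor H K M _ _)
    simp only [DoubleBurnside.tensor_of, BisetClass.tensor_assoc]
  exact DFunLike.congr_fun (DFunLike.congr_fun (DFunLike.congr_fun key x) y) z

/-- The double Burnside ring `B(G, G)` of a finite group, with product `[X] · [Y] = [X ×_G Y]`. -/
noncomputable instance DoubleBurnside.ring (G : Type) [Group G] [Finite G] :
    Ring (DoubleBurnside G G) :=
  { DoubleBurnside.addCommGroup G G with
    mul := fun x y => DoubleBurnside.tensor G G G x y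
    one := DoubleBurnside.of (BisetClass.mk (FinBiset.regular G))
    mul_assoc := DoubleBurnside.tensor_assoc
    left_distrib := fun x y z => map_add (DoubleBurnside.tensor G G G x) y z
    right_distrib := fun x y z =>
      DFunLike.congr_fun (map_add (DoubleBurnside.tensor G G G) x y) z
    zero_mul := fun x => DFunLike.congr_fun (map_zero (DoubleBurnside.tensor G G G)) x
    mul_zero := fun x => map_zero (DoubleBurnside.tensor G G G x)
    one_mul := fun x => DFunLike.congr_fun
      (f := DoubleBurnside.tensor G G G (DoubleBurnside.of (BisetClass.mk (FinBiset.regular G))))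
      (g := AddMonoidHom.id _)
      (DoubleBurnside.hom_ext fun X => by
        rw [DoubleBurnside.tensor_of, BisetClass.one_tensor, AddMonoidHom.id_apply]) x
    mul_one := fun x => DFunLike.congr_fun
      (f := (DoubleBurnside.tensor G G G).flip
        (DoubleBurnside.of (BisetClass.mk (FinBiset.regular G))))
      (g := AddMonoidHom.id _)
      (DoubleBurnside.hom_ext fun X => by
        rw [AddMonoidHom.flip_apply, DoubleBurnside.tensor_of, BisetClass.tensor_one,
          AddMonoidHom.id_apply]) x }

/-- The rational double Burnside algebra `ℚB(G, G) = ℚ ⊗_ℤ B(G, G)`. -/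
abbrev RatDoubleBurnside (G : Type) [Group G] [Finite G] : Type 1 :=
  ℚ ⊗[ℤ] DoubleBurnside G G

/-- The transitive biset `(G × H)/L`, where `g · (a, b)L = (g a, b)L` and
`(a, b)L · h = (a, h⁻¹ b)L`. -/
def FinBiset.transitive {G H : Type} [Group G] [Group H] [Finite G] [Finite H]
    (L : Subgroup (G × H)) : FinBiset G H where
  carrier := (G × H) ⧸ L
  left :=
    { smul := fun g x => ((g, 1) : G × H) • x
      one_smul := fun x => one_smul (G × H) x
      mul_smul := fun g g' x => by
        change ((g * g', 1) : G × H) • x = ((g, 1) : G × H) • ((g', 1) : G × H) • x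
        rw [smul_smul, Prod.mk_mul_mk, one_mul] }
  right :=
    { smul := fun h x => ((1, h.unop⁻¹) : G × H) • x
      one_smul := fun x => by
        change ((1, (1 : H)⁻¹) : G × H) • x = x
        rw [inv_one]
        exact one_smul (G × H) x
      mul_smul := fun h h' x => by
        change ((1, (h'.unop * h.unop)⁻¹) : G × H) • x =
          ((1, h.unop⁻¹) : G × H) • ((1, h'.unop⁻¹) : G × H) • x
        rw [smul_smul, Prod.mk_mul_mk, one_mul, mul_inv_rev] }
  comm := by
    refine @SMulCommClass.mk _ _ _ (_) (_) ?_
    intro g h x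
    change ((g, 1) : G × H) • ((1, h.unop⁻¹) : G × H) • x =
      ((1, h.unop⁻¹) : G × H) • ((g, 1) : G × H) • x
    rw [smul_smul, smul_smul, Prod.mk_mul_mk, Prod.mk_mul_mk]
    simp

/-- The element `[(G × G)/L]` of `ℚB(G, G)`. -/
noncomputable def transitiveClass {G : Type} [Group G] [Finite G] (L : Subgroup (G × G)) :
    RatDoubleBurnside G :=
  (1 : ℚ) ⊗ₜ[ℤ] DoubleBurnside.of (BisetClass.mk (FinBiset.transitive L))

/-! ### The case of the symmetric group of degree three -/

/-- The symmetric group of degree three. -/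
abbrev SymThree : Type := Equiv.Perm (Fin 3)

/-- Representatives `1`, `2`, `3`, `S₃` of the conjugacy classes of subgroups of `S₃`. -/
def symThreeSub : Fin 4 → Subgroup SymThree :=
  ![⊥, Subgroup.zpowers (Equiv.swap 0 1), alternatingGroup (Fin 3), ⊤]

/-- The subgroup `{(a, b) ∈ P × Q : sign a = sign b}` of `S₃ × S₃`. For `P`, `Q` not contained in
`A₃` it is the graph of the isomorphism `P/(P ∩ A₃) → Q/(Q ∩ A₃)` of groups of order two. -/
def signGraph (P Q : Subgroup SymThree) : Subgroup (SymThree × SymThree) :=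
  P.prod Q ⊓ MonoidHom.eqLocus (Equiv.Perm.sign.comp (MonoidHom.fst SymThree SymThree))
    (Equiv.Perm.sign.comp (MonoidHom.snd SymThree SymThree))

/-- The diagonal subgroup `{(a, a) : a ∈ P}` of `S₃ × S₃`, i.e. the graph of the identity of
`P = P/1`. -/
def diagGraph (P : Subgroup SymThree) : Subgroup (SymThree × SymThree) :=
  P.map ((MonoidHom.id SymThree).prod (MonoidHom.id SymThree))

/-- Representatives `L₁, …, L₂₂` of the conjugacy classes of subgroups of `S₃ × S₃`; the entry with
index `i : Fin 22` is `L_{i+1}`. A subgroup is the graph of an isomorphism `P₁/K₁ → P₂/K₂`; here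
`L₁, …, L₁₆` run over the pairs of sections `(P, P)`, `L₁₇, …, L₂₀` over the pairs of sections
`(2, 1)`, `(S₃, 3)`, and `L₂₁`, `L₂₂` belong to the sections `(3, 1)` and `(S₃, 1)`. -/
def symThreePairSub : Fin 22 → Subgroup (SymThree × SymThree) :=
  let T := symThreeSub
  ![(T 0).prod (T 0), (T 0).prod (T 1), (T 0).prod (T 2), (T 0).prod (T 3),
    (T 1).prod (T 0), (T 1).prod (T 1), (T 1).prod (T 2), (T 1).prod (T 3),
    (T 2).prod (T 0), (T 2).prod (T 1), (T 2).prod (T 2), (T 2).prod (T 3),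
    (T 3).prod (T 0), (T 3).prod (T 1), (T 3).prod (T 2), (T 3).prod (T 3),
    signGraph (T 1) (T 1), signGraph (T 1) (T 3),
    signGraph (T 3) (T 1), signGraph (T 3) (T 3),
    diagGraph (T 2),
    diagGraph (T 3)]

/-- The modified table of marks `M'` of `S₃ × S₃`; the entry with indices `i j : Fin 22` is
`m'_{i+1,j+1}`. -/
def modifiedMarks : Matrix (Fin 22) (Fin 22) ℚ :=
  !![6, 0, 0, 0, 0, 0, 0, 0, 0, 0, 0, 0, 0, 0, 0, 0, 0, 0, 0, 0, 0, 0;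
     3, 1, 0, 0, 0, 0, 0, 0, 0, 0, 0, 0, 0, 0, 0, 0, 0, 0, 0, 0, 0, 0;
     2, 0, 2, 0, 0, 0, 0, 0, 0, 0, 0, 0, 0, 0, 0, 0, 0, 0, 0, 0, 0, 0;
     1, 1, 1, 1, 0, 0, 0, 0, 0, 0, 0, 0, 0, 0, 0, 0, 0, 0, 0, 0, 0, 0;
     3, 0, 0, 0, 3, 0, 0, 0, 0, 0, 0, 0, 0, 0, 0, 0, 0, 0, 0, 0, 0, 0;
     3/2, 1/2, 0, 0, 3/2, 1/2, 0, 0, 0, 0, 0, 0, 0, 0, 0, 0, 0, 0, 0, 0, 0, 0;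
     1, 0, 1, 0, 1, 0, 1, 0, 0, 0, 0, 0, 0, 0, 0, 0, 0, 0, 0, 0, 0, 0;
     1/2, 1/2, 1/2, 1/2, 1/2, 1/2, 1/2, 1/2, 0, 0, 0, 0, 0, 0, 0, 0, 0, 0, 0, 0, 0, 0;
     2, 0, 0, 0, 0, 0, 0, 0, 4, 0, 0, 0, 0, 0, 0, 0, 0, 0, 0, 0, 0, 0;
     1, 1/3, 0, 0, 0, 0, 0, 0, 2, 2/3, 0, 0, 0, 0, 0, 0, 0, 0, 0, 0, 0, 0;
     2/3, 0, 2/3, 0, 0, 0, 0, 0, 4/3, 0, 4/3, 0, 0, 0, 0, 0, 0, 0, 0, 0, 0, 0;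
     1/3, 1/3, 1/3, 1/3, 0, 0, 0, 0, 2/3, 2/3, 2/3, 2/3, 0, 0, 0, 0, 0, 0, 0, 0, 0, 0;
     1, 0, 0, 0, 3, 0, 0, 0, 2, 0, 0, 0, 6, 0, 0, 0, 0, 0, 0, 0, 0, 0;
     1/2, 1/6, 0, 0, 3/2, 1/2, 0, 0, 1, 1/3, 0, 0, 3, 1, 0, 0, 0, 0, 0, 0, 0, 0;
     1/3, 0, 1/3, 0, 1, 0, 1, 0, 2/3, 0, 2/3, 0, 2, 0, 2, 0, 0, 0, 0, 0, 0, 0;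
     1/6, 1/6, 1/6, 1/6, 1/2, 1/2, 1/2, 1/2, 1/3, 1/3, 1/3, 1/3, 1, 1, 1, 1, 0, 0, 0, 0, 0, 0;
     3, 0, 0, 0, 0, 1, 0, 0, 0, 0, 0, 0, 0, 0, 0, 0, 1, 0, 0, 0, 0, 0;
     1, 0, 1, 0, 0, 1, 0, 1, 0, 0, 0, 0, 0, 0, 0, 0, 1, 1, 0, 0, 0, 0;
     1, 0, 0, 0, 0, 1, 0, 0, 2, 0, 0, 0, 0, 2, 0, 0, 1, 0, 2, 0, 0, 0;
     1/3, 0, 1/3, 0, 0, 1, 0, 1, 2/3, 0, 2/3, 0, 0, 2, 0, 2, 1, 1, 2, 2, 0, 0;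
     2, 0, 0, 0, 0, 0, 0, 0, 0, 0, 2, 0, 0, 0, 0, 0, 0, 0, 0, 0, 2, 0;
     1, 0, 0, 0, 0, 1, 0, 0, 0, 0, 1, 0, 0, 0, 0, 0, 1, 0, 0, 0, 1, 1]

/-!
The point `x` of a `(G, G)`-biset has the stabilizer `{(g, h) | g x = x h} ≤ G × G`. The stabilizer
of the class of `(x, y)` in a tensor product is the composition, as relations, of the stabilizers of
`x` and `y`, and the orbit of `(x, y)` has `|G| / κ` elements, where `κ` counts the `h` with
`(1, h)` in the first stabilizer and `(h, 1)` in the second. Hence a conjugation invariant function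
`F` of subgroups gives a linear form `[X] ↦ ∑ x, F (stab x)` on `ℚB(G, G)` whose values on products
of transitive bisets are known (`stabForm_transitiveClass_mul`, a form of the Mackey formula).

For `G = S₃`, let `F` depend on the class of the subgroup through the columns of the modified table
of marks, multiplied by the orders of the subgroups. The resulting `22` linear forms take the
values `modifiedMarks i k` on the classes of the `22` transitive bisets. This matrix is triangular
and invertible, so they are the coordinate forms of the second basis as soon as these classes span.
Spanning amounts to the classification of the subgroups of `S₃ × S₃` (`exists_eq_conjSub`): after a
conjugation, such a subgroup is the product of its intersection with `A₃ × A₃` and a subgroup of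
`⟨t⟩ × ⟨t⟩`, where `t` is a transposition.

The conjugacy class of a subgroup is determined by the products of conjugacy classes of `S₃` which
it meets, so the Mackey formula becomes a finite computation with subsets of `S₃`. It shows that the
second basis multiplies like a system of matrix units (`prodCoord`, `coordForm_mul`): the elements
`c₁, …, c₁₆` form a `4 × 4` block and `c₁₇, …, c₂₀` a `2 × 2` block, except that products through
the last row and column of a block vanish, while `c₂₁` and `c₂₂` are idempotents and `c₂₂` acts as the
identity on the last row and column of either block. Forgetting these rows and columns is a
surjective homomorphism onto `ℚ^{3×3} × ℚ × ℚ × ℚ`. The cube of every element of its kernel is zero,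
and its image is semisimple, so the kernel is the Jacobson radical.
-/

/-! ### Stabilizers of points of bisets -/

section Stabilizers

variable {G H K : Type} [Group G] [Group H] [Group K]

/-- The stabilizer of a point of a biset, encoded as the subgroup of all `(g, h)` such that
`g · x = x · h`. -/
def FinBiset.stab (X : FinBiset G H) (x : X.carrier) : Subgroup (G × H) where
  carrier := {p | p.1 • x = MulOpposite.op p.2 • x}
  one_mem' := by simp
  mul_mem' := by
    rintro ⟨a, b⟩ ⟨a', b'⟩ (h : a • x = _) (h' : a' • x = _)
    change (a * a') • x = MulOpposite.op (b * b') • x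
    rw [mul_smul, h', smul_comm, h, smul_smul, ← MulOpposite.op_mul]
  inv_mem' := by
    rintro ⟨a, b⟩ (h : a • x = _)
    change a⁻¹ • x = MulOpposite.op b⁻¹ • x
    rw [inv_smul_eq_iff, smul_comm, h, smul_smul, ← MulOpposite.op_mul, mul_inv_cancel,
      MulOpposite.op_one, one_smul]

theorem FinBiset.mem_stab {X : FinBiset G H} {x : X.carrier} {p : G × H} :
    p ∈ X.stab x ↔ p.1 • x = MulOpposite.op p.2 • x := Iff.rfl

theorem FinBiset.stab_equiv {X Y : FinBiset G H} (e : X.carrier ≃ Y.carrier)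
    (h1 : ∀ (g : G) (x : X.carrier), e (g • x) = g • e x)
    (h2 : ∀ (h : Hᵐᵒᵖ) (x : X.carrier), e (h • x) = h • e x) (x : X.carrier) :
    Y.stab (e x) = X.stab x := by
  ext p
  rw [mem_stab, mem_stab, ← h1, ← h2, e.apply_eq_iff_eq]

/-- Composition of subgroups of `G × H` and `H × K` as relations. -/
def relComp (L : Subgroup (G × H)) (M : Subgroup (H × K)) : Subgroup (G × K) where
  carrier := {p | ∃ h, (p.1, h) ∈ L ∧ (h, p.2) ∈ M}
  one_mem' := ⟨1, L.one_mem, M.one_mem⟩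
  mul_mem' := by
    rintro p q ⟨h, h1, h2⟩ ⟨k, k1, k2⟩
    exact ⟨h * k, L.mul_mem h1 k1, M.mul_mem h2 k2⟩
  inv_mem' := by
    rintro p ⟨h, h1, h2⟩
    exact ⟨h⁻¹, L.inv_mem h1, M.inv_mem h2⟩

theorem mem_relComp {L : Subgroup (G × H)} {M : Subgroup (H × K)} {p : G × K} :
    p ∈ relComp L M ↔ ∃ h, (p.1, h) ∈ L ∧ (h, p.2) ∈ M := Iff.rfl

/-- The number of `h` with `(1, h) ∈ L` and `(h, 1) ∈ M`. When `L` and `M` are the stabilizers of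
`x` and `y`, these are the elements `h` fixing `(x, y)` in the action whose orbits form the tensor
product. -/
noncomputable def middleCard (L : Subgroup (G × H)) (M : Subgroup (H × K)) : ℕ :=
  Nat.card {h : H // ((1, h) : G × H) ∈ L ∧ ((h, 1) : H × K) ∈ M}

/-- The class of a pair of points in the tensor product. -/
def FinBiset.tensorMk (X : FinBiset G H) (Y : FinBiset H K) :
    X.carrier × Y.carrier → (X.tensor Y).carrier :=
  Quotient.mk (tensorSetoid X Y)

theorem FinBiset.stab_tensor (X : FinBiset G H) (Y : FinBiset H K) (x : X.carrier)
    (y : Y.carrier) :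
    (X.tensor Y).stab (X.tensorMk Y (x, y)) =
      relComp (X.stab x) (Y.stab y) := by
  ext ⟨g, k⟩
  change Quotient.mk (tensorSetoid X Y) (g • x, y) =
    Quotient.mk (tensorSetoid X Y) (x, MulOpposite.op k • y) ↔ _
  rw [Quotient.eq]
  constructor
  · rintro ⟨h, hh⟩
    obtain ⟨h1, h2⟩ := Prod.mk.inj hh
    refine ⟨h⁻¹, ?_, ?_⟩
    · change g • x = MulOpposite.op h⁻¹ • x
      have h1 : x = MulOpposite.op h • g • x := h1
      conv_rhs => rw [h1]
      rw [smul_smul, ← MulOpposite.op_mul, mul_inv_cancel, MulOpposite.op_one, one_smul]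
    · exact h2.symm
  · rintro ⟨h, h1, h2⟩
    refine ⟨h⁻¹, Prod.ext ?_ ?_⟩
    · change x = MulOpposite.op h⁻¹ • g • x
      have h1 : g • x = MulOpposite.op h • x := h1
      rw [h1, smul_smul, ← MulOpposite.op_mul, mul_inv_cancel, MulOpposite.op_one, one_smul]
    · change MulOpposite.op k • y = h⁻¹⁻¹ • y
      rw [inv_inv]
      exact h2.symm

theorem sum_middleCard_orbit [Finite H] (X : FinBiset G H) (Y : FinBiset H K)
    [Fintype X.carrier] [Fintype Y.carrier] [DecidableEq (X.tensor Y).carrier]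
    (z : (X.tensor Y).carrier) :
    ∑ p : X.carrier × Y.carrier with X.tensorMk Y p = z,
      middleCard (X.stab p.1) (Y.stab p.2) = Nat.card H := by
  classical
  have := Fintype.ofFinite H
  obtain ⟨⟨x, y⟩, rfl⟩ := Quotient.exists_rep z
  -- The map `h ↦ (x · h, h⁻¹ · y)` is onto the orbit, and its fibres are cosets of stabilizers.
  rw [Nat.card_eq_fintype_card, ← Finset.card_univ, Finset.card_eq_sum_card_fiberwise
    (f := fun h : H => ((MulOpposite.op h • x, h⁻¹ • y) : X.carrier × Y.carrier))
    (t := {p | X.tensorMk Y p = X.tensorMk Y (x, y)})]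
  · refine Finset.sum_congr rfl fun p hp => ?_
    obtain ⟨h₀, hh⟩ := Quotient.exact (Finset.mem_filter.1 hp).2.symm
    obtain rfl := hh
    rw [middleCard, Nat.card_eq_fintype_card, Fintype.card_subtype]
    refine Finset.card_bij' (fun h _ => h₀ * h) (fun h _ => h₀⁻¹ * h) ?_ ?_ ?_ ?_
    · intro h hh
      simp only [Finset.mem_filter, Finset.mem_univ, true_and] at hh ⊢
      obtain ⟨h1, h2⟩ := hh
      rw [FinBiset.mem_stab] at h1 h2
      simp only [one_smul, MulOpposite.op_one] at h1 h2
      refine Prod.ext ?_ ?_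
      · change MulOpposite.op (h₀ * h) • x = MulOpposite.op h₀ • x
        rw [h1, MulOpposite.op_mul, mul_smul]
      · change (h₀ * h)⁻¹ • y = h₀⁻¹ • y
        rw [mul_inv_rev, mul_smul, inv_smul_eq_iff, h2]
    · intro h hh
      simp only [Finset.mem_filter, Finset.mem_univ, true_and] at hh ⊢
      obtain ⟨h1, h2⟩ := Prod.mk.inj hh
      have h2 : h⁻¹ • y = h₀⁻¹ • y := h2
      refine ⟨?_, ?_⟩
      · change (1 : G) • MulOpposite.op h₀ • x =
          MulOpposite.op (h₀⁻¹ * h) • MulOpposite.op h₀ • x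
        rw [smul_smul (MulOpposite.op (h₀⁻¹ * h)), ← MulOpposite.op_mul, mul_inv_cancel_left,
          one_smul, ← h1]
      · change (h₀⁻¹ * h) • h₀⁻¹ • y = MulOpposite.op (1 : K) • h₀⁻¹ • y
        rw [MulOpposite.op_one, one_smul, mul_smul, ← h2, smul_inv_smul, h2]
    · intro h _
      simp
    · intro h _
      simp
  · intro h _
    simp only [Finset.coe_filter, Finset.mem_univ, true_and, Set.mem_ofPred_eq]
    exact (Quotient.sound (s := tensorSetoid X Y) (a := (x, y)) ⟨h, rfl⟩).symm

end Stabilizers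

/-! ### Additive invariants given by functions of the stabilizer -/

section StabSum

variable {G H K : Type} [Group G] [Group H] [Group K]

/-- The additive invariant `X ↦ ∑ x, F (stab x)` of bisets attached to a function `F` on
subgroups. -/
noncomputable def stabSum (F : Subgroup (G × H) → ℚ) : BisetClass G H →+ ℚ where
  toFun := Quotient.lift (fun X : FinBiset G H => ∑ᶠ x, F (X.stab x)) (by
    rintro X Y ⟨e, h1, h2⟩
    exact finsum_eq_of_bijective e e.bijective fun x => by rw [FinBiset.stab_equiv e h1 h2])
  map_zero' := by
    change ∑ᶠ x : Empty, F ((FinBiset.empty G H).stab x) = 0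
    exact finsum_of_isEmpty _
  map_add' := by
    rintro ⟨X⟩ ⟨Y⟩
    have := Fintype.ofFinite X.carrier
    have := Fintype.ofFinite Y.carrier
    change ∑ᶠ x : X.carrier ⊕ Y.carrier, F ((X.sum Y).stab x) =
      ∑ᶠ x, F (X.stab x) + ∑ᶠ x, F (Y.stab x)
    rw [finsum_eq_sum_of_fintype, finsum_eq_sum_of_fintype, finsum_eq_sum_of_fintype,
      Fintype.sum_sum_type]
    congr 1
    · refine Finset.sum_congr rfl fun x _ => congrArg F (Subgroup.ext fun p => ?_)
      exact Sum.inl_injective.eq_iff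
    · refine Finset.sum_congr rfl fun x _ => congrArg F (Subgroup.ext fun p => ?_)
      exact Sum.inr_injective.eq_iff

theorem stabSum_mk (F : Subgroup (G × H) → ℚ) (X : FinBiset G H) [Fintype X.carrier] :
    stabSum F (BisetClass.mk X) = ∑ x, F (X.stab x) :=
  finsum_eq_sum_of_fintype _

/-- Summing over the points of a tensor product amounts to summing over pairs of points, weighted by
the orders of their stabilizers. -/
theorem stabSum_tensor [Finite H] (F : Subgroup (G × K) → ℚ) (X : FinBiset G H)
    (Y : FinBiset H K) [Fintype X.carrier] [Fintype Y.carrier] :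
    (Nat.card H : ℚ) * stabSum F (BisetClass.mk (X.tensor Y)) =
      ∑ x, ∑ y, (middleCard (X.stab x) (Y.stab y) : ℚ) * F (relComp (X.stab x) (Y.stab y)) := by
  classical
  have := Fintype.ofFinite (X.tensor Y).carrier
  rw [stabSum_mk, Finset.mul_sum, ← Fintype.sum_prod_type', ← Finset.sum_fiberwise _ (X.tensorMk Y)]
  refine Finset.sum_congr rfl fun z _ => ?_
  rw [← sum_middleCard_orbit X Y z, Nat.cast_sum, Finset.sum_mul]
  refine Finset.sum_congr rfl fun p hp => ?_
  rw [← (Finset.mem_filter.1 hp).2, FinBiset.stab_tensor]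

/-- The conjugate of a subgroup of `G × H`. -/
def conjSub (c : G × H) (L : Subgroup (G × H)) : Subgroup (G × H) :=
  L.map (MulAut.conj c).toMonoidHom

theorem mem_conjSub {c p : G × H} {L : Subgroup (G × H)} :
    p ∈ conjSub c L ↔ c⁻¹ * p * c ∈ L := by
  rw [conjSub, Subgroup.mem_map]
  constructor
  · rintro ⟨q, hq, rfl⟩
    simpa [mul_assoc] using hq
  · intro h
    exact ⟨_, h, by simp [mul_assoc]⟩

theorem conjSub_conjSub (c d : G × H) (L : Subgroup (G × H)) :
    conjSub c (conjSub d L) = conjSub (c * d) L := by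
  ext p
  simp only [mem_conjSub, mul_inv_rev, mul_assoc]

theorem conjSub_one (L : Subgroup (G × H)) : conjSub 1 L = L := by
  ext p
  simp [mem_conjSub]

theorem FinBiset.stab_transitive [Finite G] [Finite H] (L : Subgroup (G × H)) (c : G × H) :
    (FinBiset.transitive L).stab (QuotientGroup.mk c : (G × H) ⧸ L) = conjSub c L := by
  ext ⟨g, h⟩
  rw [mem_conjSub]
  change (QuotientGroup.mk (((g, 1) : G × H) * c) : (G × H) ⧸ L) =
    QuotientGroup.mk (((1, h⁻¹) : G × H) * c) ↔ _
  rw [eq_comm, QuotientGroup.eq]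
  have : (((1, h⁻¹) : G × H) * c)⁻¹ * (((g, 1) : G × H) * c) = c⁻¹ * (g, h) * c := by
    ext <;> simp [mul_assoc]
  rw [this]

/-- A sum over the points of a transitive biset as an average over the group. -/
theorem card_mul_sum_transitive [Finite G] [Finite H] (L : Subgroup (G × H)) [Fintype G]
    [Fintype H] [Fintype (FinBiset.transitive L).carrier] (f : Subgroup (G × H) → ℚ) :
    (Nat.card L : ℚ) * ∑ x, f ((FinBiset.transitive L).stab x) =
      ∑ c : G × H, f (conjSub c L) := by
  classical
  let q : G × H → (FinBiset.transitive L).carrier := fun c => (QuotientGroup.mk c : (G × H) ⧸ L)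
  rw [Finset.mul_sum, ← Finset.sum_fiberwise _ q]
  refine Finset.sum_congr rfl fun z _ => ?_
  obtain ⟨c, rfl⟩ := QuotientGroup.mk_surjective z
  have hc : Nat.card L = ({d | q d = q c} : Finset (G × H)).card := by
    have h := QuotientGroup.card_preimage_mk L {(QuotientGroup.mk c : (G × H) ⧸ L)}
    rw [Nat.card_coe_set_eq {_}, Set.ncard_singleton, mul_one] at h
    rw [← h, ← Fintype.card_subtype, ← Nat.card_eq_fintype_card]
    rfl
  rw [hc, ← nsmul_eq_mul, ← Finset.sum_const]
  refine Finset.sum_congr rfl fun d hd => ?_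
  rw [← FinBiset.stab_transitive L d]
  exact congrArg (fun z => f ((FinBiset.transitive L).stab z)) (Finset.mem_filter.1 hd).2.symm

end StabSum

/-! ### Products of transitive bisets -/

section Product

theorem relComp_conjSub {G H K : Type} [Group G] [Group H] [Group K] (c₁ : G) (c₂ d₁ : H)
    (d₂ : K) (L : Subgroup (G × H)) (M : Subgroup (H × K)) :
    relComp (conjSub (c₁, c₂) L) (conjSub (d₁, d₂) M) =
      conjSub (c₁, d₂) (relComp L (conjSub (c₂⁻¹ * d₁, 1) M)) := by
  ext ⟨g, k⟩
  simp only [mem_relComp, mem_conjSub, Prod.inv_mk, Prod.mk_mul_mk, mul_inv_rev, inv_inv, inv_one,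
    one_mul, mul_one]
  constructor
  · rintro ⟨h, h1, h2⟩
    exact ⟨c₂⁻¹ * h * c₂, h1, by simpa [mul_assoc] using h2⟩
  · rintro ⟨h, h1, h2⟩
    exact ⟨c₂ * h * c₂⁻¹, by simpa [mul_assoc] using h1, by simpa [mul_assoc] using h2⟩

theorem middleCard_conjSub {G H K : Type} [Group G] [Group H] [Group K] (c₁ : G) (c₂ d₁ : H)
    (d₂ : K) (L : Subgroup (G × H)) (M : Subgroup (H × K)) :
    middleCard (conjSub (c₁, c₂) L) (conjSub (d₁, d₂) M) =
      middleCard L (conjSub (c₂⁻¹ * d₁, 1) M) := by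
  refine Nat.card_congr ((MulAut.conj c₂⁻¹).toEquiv.subtypeEquiv fun h => ?_)
  simp [mem_conjSub, mul_assoc]

variable {G : Type} [Group G] [Finite G]

/-- The Mackey formula for the product of two transitive bisets, seen through a conjugation
invariant function `F` of stabilizers. -/
theorem stabSum_transitive_tensor [Fintype G] (F : Subgroup (G × G) → ℚ)
    (hF : ∀ c L, F (conjSub c L) = F L) (L M : Subgroup (G × G)) :
    (Nat.card L : ℚ) * Nat.card M *
        stabSum F (BisetClass.mk ((FinBiset.transitive L).tensor (FinBiset.transitive M))) =
      (Nat.card G : ℚ) ^ 2 * ∑ a : G, (middleCard L (conjSub (a, 1) M) : ℚ) *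
        F (relComp L (conjSub (a, 1) M)) := by
  have := Fintype.ofFinite (FinBiset.transitive L).carrier
  have := Fintype.ofFinite (FinBiset.transitive M).carrier
  have hG : (Nat.card G : ℚ) ≠ 0 := Nat.cast_ne_zero.2 Nat.card_pos.ne'
  refine mul_left_cancel₀ hG ?_
  calc _ = (Nat.card L : ℚ) * ∑ x, (Nat.card M : ℚ) * ∑ y,
        (middleCard ((FinBiset.transitive L).stab x) ((FinBiset.transitive M).stab y) : ℚ) *
          F (relComp ((FinBiset.transitive L).stab x) ((FinBiset.transitive M).stab y)) := by
        rw [← Finset.mul_sum, ← stabSum_tensor]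
        ring
    _ = ∑ c : G × G, ∑ d : G × G, (middleCard (conjSub c L) (conjSub d M) : ℚ) *
          F (relComp (conjSub c L) (conjSub d M)) := by
        rw [← card_mul_sum_transitive L fun S => ∑ d : G × G,
          (middleCard S (conjSub d M) : ℚ) * F (relComp S (conjSub d M))]
        congr 1
        refine Finset.sum_congr rfl fun x _ => ?_
        exact card_mul_sum_transitive M fun S =>
          (middleCard ((FinBiset.transitive L).stab x) S : ℚ) *
            F (relComp ((FinBiset.transitive L).stab x) S)
    _ = ∑ _c₁ : G, ∑ c₂ : G, ∑ d₁ : G, ∑ _d₂ : G,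
          (middleCard L (conjSub (c₂⁻¹ * d₁, 1) M) : ℚ) *
            F (relComp L (conjSub (c₂⁻¹ * d₁, 1) M)) := by
        simp only [Fintype.sum_prod_type, relComp_conjSub, middleCard_conjSub, hF]
    _ = ∑ _c₁ : G, ∑ _c₂ : G, ∑ a : G, ∑ _d₂ : G,
          (middleCard L (conjSub (a, 1) M) : ℚ) * F (relComp L (conjSub (a, 1) M)) := by
        refine Finset.sum_congr rfl fun _ _ => Finset.sum_congr rfl fun c₂ _ => ?_
        exact Equiv.sum_comp (Equiv.mulLeft c₂⁻¹) fun a => ∑ _d₂ : G,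
          (middleCard L (conjSub (a, 1) M) : ℚ) * F (relComp L (conjSub (a, 1) M))
    _ = _ := by
        simp only [Finset.sum_const, Finset.card_univ, nsmul_eq_mul, ← Finset.mul_sum,
          Nat.card_eq_fintype_card]
        ring

/-- The linear form on `ℚB(G, G)` induced by `stabSum`. -/
noncomputable def stabForm (F : Subgroup (G × G) → ℚ) : RatDoubleBurnside G →ₗ[ℚ] ℚ :=
  LinearMap.liftBaseChange ℚ (DoubleBurnside.lift (stabSum F)).toIntLinearMap

theorem stabForm_of (F : Subgroup (G × G) → ℚ) (X : BisetClass G G) :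
    stabForm F ((1 : ℚ) ⊗ₜ[ℤ] DoubleBurnside.of X) = stabSum F X := by
  rw [stabForm, LinearMap.liftBaseChange_tmul, one_smul]
  exact DoubleBurnside.lift_of _ _

theorem stabForm_transitiveClass (F : Subgroup (G × G) → ℚ)
    (hF : ∀ c L, F (conjSub c L) = F L) (L : Subgroup (G × G)) :
    (Nat.card L : ℚ) * stabForm F (transitiveClass L) = (Nat.card G : ℚ) ^ 2 * F L := by
  have := Fintype.ofFinite G
  have := Fintype.ofFinite (FinBiset.transitive L).carrier
  rw [transitiveClass, stabForm_of, stabSum_mk, card_mul_sum_transitive L F]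
  simp only [hF, Finset.sum_const, Finset.card_univ, nsmul_eq_mul, Nat.card_eq_fintype_card,
    Fintype.card_prod]
  push_cast
  ring

theorem transitiveClass_mul (L M : Subgroup (G × G)) :
    transitiveClass L * transitiveClass M = (1 : ℚ) ⊗ₜ[ℤ] DoubleBurnside.of
      (BisetClass.mk ((FinBiset.transitive L).tensor (FinBiset.transitive M))) := by
  rw [transitiveClass, transitiveClass, Algebra.TensorProduct.tmul_mul_tmul, one_mul]
  exact congrArg _ (DoubleBurnside.tensor_of _ _)

theorem stabForm_transitiveClass_mul [Fintype G] (F : Subgroup (G × G) → ℚ)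
    (hF : ∀ c L, F (conjSub c L) = F L) (L M : Subgroup (G × G)) :
    (Nat.card L : ℚ) * Nat.card M * stabForm F (transitiveClass L * transitiveClass M) =
      (Nat.card G : ℚ) ^ 2 * ∑ a : G, (middleCard L (conjSub (a, 1) M) : ℚ) *
        F (relComp L (conjSub (a, 1) M)) := by
  rw [transitiveClass_mul, stabForm_of, stabSum_transitive_tensor F hF]

end Product

/-! ### Classes of transitive bisets span -/

section Span

variable {G : Type} [Group G] [Finite G]

theorem transitiveClass_conjSub (c : G × G) (L : Subgroup (G × G)) :
    transitiveClass (conjSub c L) = transitiveClass L := by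
  unfold transitiveClass
  congr 2
  -- The bijection is `p · L^c ↦ p c · L`.
  refine Quotient.sound ⟨⟨
    Quotient.map' (fun p => p * c) fun p q h => ?_,
    Quotient.map' (fun p => p * c⁻¹) fun p q h => ?_, ?_, ?_⟩, ?_, ?_⟩
  · rw [QuotientGroup.leftRel_apply] at h ⊢
    rw [mem_conjSub] at h
    simpa [mul_assoc] using h
  · rw [QuotientGroup.leftRel_apply] at h ⊢
    rw [mem_conjSub]
    simpa [mul_assoc] using h
  · rintro ⟨p⟩
    exact congrArg Quotient.mk'' (mul_inv_cancel_right p c)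
  · rintro ⟨p⟩
    exact congrArg Quotient.mk'' (inv_mul_cancel_right p c)
  · rintro g ⟨p⟩
    exact congrArg Quotient.mk'' (mul_assoc _ p c)
  · rintro g ⟨p⟩
    exact congrArg Quotient.mk'' (mul_assoc _ p c)

/-- Every nonempty biset is the disjoint union of a transitive biset and a smaller one. -/
theorem FinBiset.exists_mk_eq_transitive_add (X : FinBiset G G) (x : X.carrier) :
    ∃ Y : FinBiset G G, Nat.card Y.carrier < Nat.card X.carrier ∧
      BisetClass.mk X = BisetClass.mk (FinBiset.transitive (X.stab x)) + BisetClass.mk Y := by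
  classical
  let O : Set X.carrier := {y | ∃ p : G × G, y = p.1 • MulOpposite.op p.2⁻¹ • x}
  have hl : ∀ (g : G) (y : X.carrier), g • y ∈ O ↔ y ∈ O := by
    have key : ∀ (g : G) (y : X.carrier), y ∈ O → g • y ∈ O := by
      rintro g _ ⟨p, rfl⟩
      exact ⟨(g * p.1, p.2), by simp [mul_smul]⟩
    exact fun g y => ⟨fun h => by simpa using key g⁻¹ _ h, key g y⟩
  have hr : ∀ (h : Gᵐᵒᵖ) (y : X.carrier), h • y ∈ O ↔ y ∈ O := by
    have key : ∀ (h : Gᵐᵒᵖ) (y : X.carrier), y ∈ O → h • y ∈ O := by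
      rintro h _ ⟨p, rfl⟩
      refine ⟨(p.1, h.unop⁻¹ * p.2), ?_⟩
      simp [mul_smul, ← smul_comm p.1 h]
    exact fun h y => ⟨fun hy => by simpa using key h⁻¹ _ hy, key h y⟩
  let Y : FinBiset G G :=
    { carrier := {y // y ∉ O}
      left :=
        { smul := fun g y => ⟨g • y.1, fun h => y.2 ((hl g y).1 h)⟩
          one_smul := fun y => Subtype.ext (one_smul G y.1)
          mul_smul := fun g g' y => Subtype.ext (mul_smul g g' y.1) }
      right :=
        { smul := fun g y => ⟨g • y.1, fun h => y.2 ((hr g y).1 h)⟩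
          one_smul := fun y => Subtype.ext (one_smul Gᵐᵒᵖ y.1)
          mul_smul := fun g g' y => Subtype.ext (mul_smul g g' y.1) }
      comm := by
        refine @SMulCommClass.mk _ _ _ (_) (_) ?_
        exact fun g h y => Subtype.ext (smul_comm g h y.1) }
  have hx : x ∈ O := ⟨1, by simp⟩
  have hstab : ∀ p q : G × G, p.1 • MulOpposite.op p.2⁻¹ • x = q.1 • MulOpposite.op q.2⁻¹ • x ↔
      p⁻¹ * q ∈ X.stab x := by
    intro p q
    change _ ↔ (p.1⁻¹ * q.1) • x = MulOpposite.op (p.2⁻¹ * q.2) • x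
    rw [mul_smul, inv_smul_eq_iff, MulOpposite.op_mul, mul_smul, smul_comm p.1 (MulOpposite.op q.2),
      eq_comm, smul_comm q.1 (MulOpposite.op q.2⁻¹), MulOpposite.op_inv q.2, inv_smul_eq_iff]
  refine ⟨Y, ?_, ?_⟩
  · exact Finite.card_subtype_lt (x := x) (not_not.2 hx)
  · refine (Quotient.sound ?_ : BisetClass.mk ((FinBiset.transitive (X.stab x)).sum Y) = _).symm
    let f : ((FinBiset.transitive (X.stab x)).sum Y).carrier → X.carrier :=
      Sum.elim (Quotient.lift (fun p : G × G => p.1 • MulOpposite.op p.2⁻¹ • x)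
        fun p q h => (hstab p q).2 (QuotientGroup.leftRel_apply.1 h)) Subtype.val
    have hf : Function.Bijective f := by
      constructor
      · rintro (p | y) (q | z) h
        · obtain ⟨p, rfl⟩ := QuotientGroup.mk_surjective p
          obtain ⟨q, rfl⟩ := QuotientGroup.mk_surjective q
          exact congrArg Sum.inl (QuotientGroup.eq.2 ((hstab p q).1 h))
        · obtain ⟨p, rfl⟩ := QuotientGroup.mk_surjective p
          exact (z.2 ⟨p, h.symm⟩).elim
        · obtain ⟨q, rfl⟩ := QuotientGroup.mk_surjective q
          exact (y.2 ⟨q, h⟩).elim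
        · exact congrArg Sum.inr (Subtype.ext h)
      · intro y
        by_cases hy : y ∈ O
        · obtain ⟨p, rfl⟩ := hy
          exact ⟨Sum.inl (QuotientGroup.mk p), rfl⟩
        · exact ⟨Sum.inr ⟨y, hy⟩, rfl⟩
    refine ⟨Equiv.ofBijective f hf, ?_, ?_⟩
    · rintro g (p | y)
      · obtain ⟨p, rfl⟩ := QuotientGroup.mk_surjective p
        change (g * p.1) • MulOpposite.op (1 * p.2)⁻¹ • x = g • p.1 • MulOpposite.op p.2⁻¹ • x
        rw [one_mul, mul_smul]
      · rfl
    · rintro h (p | y)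
      · obtain ⟨p, rfl⟩ := QuotientGroup.mk_surjective p
        change (1 * p.1) • MulOpposite.op (h.unop⁻¹ * p.2)⁻¹ • x =
          h • p.1 • MulOpposite.op p.2⁻¹ • x
        rw [one_mul, ← smul_comm p.1 h, mul_inv_rev, inv_inv, MulOpposite.op_mul, mul_smul,
          MulOpposite.op_unop]
      · rfl

theorem span_transitiveClass :
    Submodule.span ℚ (Set.range (transitiveClass (G := G))) = ⊤ := by
  have key : ∀ (n : ℕ) (X : FinBiset G G), Nat.card X.carrier = n →
      (1 : ℚ) ⊗ₜ[ℤ] DoubleBurnside.of (BisetClass.mk X) ∈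
        Submodule.span ℚ (Set.range (transitiveClass (G := G))) := by
    intro n
    induction n using Nat.strong_induction_on with
    | _ n ih =>
      intro X hX
      rcases isEmpty_or_nonempty X.carrier with h | ⟨⟨x⟩⟩
      · have : BisetClass.mk X = 0 :=
          Quotient.sound ⟨Equiv.equivOfIsEmpty _ Empty, fun _ x => h.elim x, fun _ x => h.elim x⟩
        rw [this, map_zero, TensorProduct.tmul_zero]
        exact Submodule.zero_mem _
      · obtain ⟨Y, hY, h⟩ := X.exists_mk_eq_transitive_add x
        rw [h, map_add, TensorProduct.tmul_add]
        exact Submodule.add_mem _ (Submodule.subset_span ⟨_, rfl⟩) (ih _ (hX ▸ hY) Y rfl)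
  have hof : ∀ y : DoubleBurnside G G, (1 : ℚ) ⊗ₜ[ℤ] y ∈
      Submodule.span ℚ (Set.range (transitiveClass (G := G))) := by
    have h : (Submodule.span ℚ (Set.range (transitiveClass (G := G)))).mkQ.toAddMonoidHom.comp
        (TensorProduct.mk ℤ ℚ (DoubleBurnside G G) 1).toAddMonoidHom = 0 := by
      refine DoubleBurnside.hom_ext ?_
      rintro ⟨X⟩
      exact (Submodule.Quotient.mk_eq_zero _).2 (key _ X rfl)
    exact fun y => (Submodule.Quotient.mk_eq_zero _).1 (DFunLike.congr_fun h y)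
  rw [eq_top_iff]
  rintro z -
  induction z using TensorProduct.induction_on with
  | zero => exact Submodule.zero_mem _
  | add a b ha hb => exact Submodule.add_mem _ ha hb
  | tmul r y =>
    rw [← mul_one r, ← smul_eq_mul, ← TensorProduct.smul_tmul']
    exact Submodule.smul_mem _ _ (hof y)

end Span

/-! ### Elements and subgroups of the symmetric group of degree three -/

/-- The elements `1, r, r², t, r t, r² t` of `S₃`, where `r` is a `3`-cycle and `t = (0 1)`. -/
def permOfCode : Fin 6 → SymThree :=
  let r : SymThree := Equiv.swap 0 1 * Equiv.swap 1 2
  let t : SymThree := Equiv.swap 0 1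
  ![1, r, r * r, t, r * t, r * r * t]

theorem permOfCode_bijective : Function.Bijective permOfCode := by
  decide +kernel

/-- The conjugacy class of a permutation: `0` for the identity, `1` for transpositions, `2` for
`3`-cycles. -/
def permClass (x : SymThree) : Fin 3 :=
  if x = 1 then 0 else if Equiv.Perm.sign x = 1 then 2 else 1

theorem permClass_conj (a x : SymThree) : permClass (a⁻¹ * x * a) = permClass x := by
  revert a x
  decide +kernel

/-- `permClass` in terms of the numbering of `S₃`. -/
def codeClass (g : Fin 6) : Fin 3 := if g = 0 then 0 else if g < 3 then 2 else 1

theorem permClass_permOfCode (g : Fin 6) : permClass (permOfCode g) = codeClass g := by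
  revert g
  decide +kernel

/-- Conjugation in terms of the numbering of `S₃`; see `permOfCode_conj`. -/
def codeConj (a h : ℕ) : ℕ :=
  (([[0, 1, 2, 3, 4, 5], [0, 1, 2, 4, 5, 3], [0, 1, 2, 5, 3, 4],
    [0, 2, 1, 3, 5, 4], [0, 2, 1, 5, 4, 3], [0, 2, 1, 4, 3, 5]] : List (List ℕ)).getD a []).getD h 0

theorem exists_permOfCode_conj (a h : Fin 6) : ∃ k : Fin 6, codeConj a h = k ∧
    (permOfCode a)⁻¹ * permOfCode h * permOfCode a = permOfCode k := by
  revert a h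
  decide +kernel

/-- Membership in the subgroups `1`, `⟨t⟩`, `A₃`, `S₃` in terms of the numbering of `S₃`. -/
def memSubCode (p : ℕ) (g : Fin 6) : Bool :=
  if p = 0 then g = 0 else if p = 1 then g = 0 ∨ g = 3 else if p = 2 then g < 3 else true

theorem permOfCode_mem_symThreeSub (p : Fin 4) (g : Fin 6) :
    permOfCode g ∈ symThreeSub p ↔ memSubCode p g = true := by
  have h0 : ∀ g, permOfCode g = 1 ↔ memSubCode 0 g = true := by decide +kernel
  have h1 : ∀ g, (permOfCode g = 1 ∨ permOfCode g = Equiv.swap 0 1) ↔ memSubCode 1 g = true := by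
    decide +kernel
  have h2 : ∀ g, Equiv.Perm.sign (permOfCode g) = 1 ↔ memSubCode 2 g = true := by decide +kernel
  fin_cases p
  · exact h0 g
  · refine Iff.trans ?_ (h1 g)
    change permOfCode g ∈ Subgroup.zpowers (Equiv.swap (0 : Fin 3) 1) ↔ _
    rw [Subgroup.mem_zpowers_iff]
    constructor
    · rintro ⟨k, hk⟩
      rcases Int.even_or_odd' k with ⟨m, rfl | rfl⟩
      · left
        rw [← hk, zpow_mul, zpow_ofNat, pow_two, Equiv.swap_mul_self, one_zpow]
      · right
        rw [← hk, zpow_add, zpow_mul, zpow_ofNat, pow_two, Equiv.swap_mul_self, one_zpow, one_mul,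
          zpow_one]
    · rintro (h | h)
      · exact ⟨0, h.symm⟩
      · exact ⟨1, h.symm⟩
  · exact h2 g
  · simp [symThreeSub, memSubCode]

theorem sign_permOfCode_eq_iff (g h : Fin 6) :
    Equiv.Perm.sign (permOfCode g) = Equiv.Perm.sign (permOfCode h) ↔ (g < 3 ↔ h < 3) := by
  revert g h
  decide +kernel

/-- Membership in the subgroup with index `i` of `S₃ × S₃` in terms of the numbering of `S₃`. -/
def memPairCode (i : ℕ) (g h : Fin 6) : Bool :=
  if i < 16 then memSubCode (i / 4) g && memSubCode (i % 4) h
  else if i < 20 then memSubCode (1 + 2 * (i / 2 % 2)) g && memSubCode (1 + 2 * (i % 2)) h &&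
    (g < 3 ↔ h < 3)
  else memSubCode (i - 18) g && g = h

theorem permOfCode_mem_symThreePairSub (i : Fin 22) (g h : Fin 6) :
    (permOfCode g, permOfCode h) ∈ symThreePairSub i ↔ memPairCode i g h = true := by
  have hprod : ∀ p q : Fin 4, (permOfCode g, permOfCode h) ∈
      (symThreeSub p).prod (symThreeSub q) ↔ (memSubCode p g && memSubCode q h) = true := by
    intro p q
    rw [Subgroup.mem_prod, permOfCode_mem_symThreeSub, permOfCode_mem_symThreeSub,
      Bool.and_eq_true]
  have hsign : ∀ p q : Fin 4, (permOfCode g, permOfCode h) ∈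
      signGraph (symThreeSub p) (symThreeSub q) ↔
        (memSubCode p g && memSubCode q h && (g < 3 ↔ h < 3)) = true := by
    intro p q
    rw [signGraph, Subgroup.mem_inf, hprod, Bool.and_eq_true _ (decide _), decide_eq_true_iff,
      ← sign_permOfCode_eq_iff]
    rfl
  have hdiag : ∀ p : Fin 4, (permOfCode g, permOfCode h) ∈ diagGraph (symThreeSub p) ↔
      (memSubCode p g && g = h) = true := by
    intro p
    rw [diagGraph, Subgroup.mem_map, Bool.and_eq_true, decide_eq_true_iff,
      ← permOfCode_mem_symThreeSub, ← permOfCode_bijective.1.eq_iff]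
    constructor
    · rintro ⟨x, hx, hh⟩
      obtain ⟨rfl, hh⟩ := Prod.mk.inj hh
      exact ⟨hx, hh⟩
    · rintro ⟨hx, hh⟩
      exact ⟨_, hx, Prod.ext rfl hh⟩
  fin_cases i
  · exact hprod 0 0
  · exact hprod 0 1
  · exact hprod 0 2
  · exact hprod 0 3
  · exact hprod 1 0
  · exact hprod 1 1
  · exact hprod 1 2
  · exact hprod 1 3
  · exact hprod 2 0
  · exact hprod 2 1
  · exact hprod 2 2
  · exact hprod 2 3
  · exact hprod 3 0
  · exact hprod 3 1
  · exact hprod 3 2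
  · exact hprod 3 3
  · exact hsign 1 1
  · exact hsign 1 3
  · exact hsign 3 1
  · exact hsign 3 3
  · exact hdiag 2
  · exact hdiag 3

/-- The orders of the subgroups `L₁, …, L₂₂`. -/
def pairSubCard (i : ℕ) : ℕ :=
  [1, 2, 3, 6, 2, 4, 6, 12, 3, 6, 9, 18, 6, 12, 18, 36, 2, 6, 6, 18, 3, 6].getD i 1

theorem card_symThreePairSub (i : Fin 22) : Nat.card (symThreePairSub i) = pairSubCard i := by
  have key : ∀ i : Fin 22, Fintype.card {p : Fin 6 × Fin 6 // memPairCode i p.1 p.2 = true} =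
      pairSubCard i := by
    decide +kernel
  rw [← key, ← Nat.card_eq_fintype_card]
  refine (Nat.card_congr ?_).symm
  refine Equiv.subtypeEquiv ((Equiv.ofBijective _ permOfCode_bijective).prodCongr
    (Equiv.ofBijective _ permOfCode_bijective)) fun p => ?_
  exact (permOfCode_mem_symThreePairSub i p.1 p.2).symm

/-! ### The class of a subgroup of `S₃ × S₃` -/

/-- Whether a subgroup of `S₃ × S₃` meets the product of two conjugacy classes of `S₃`. -/
def Meets (L : Subgroup (SymThree × SymThree)) (p q : Fin 3) : Prop :=
  ∃ g h, permClass g = p ∧ permClass h = q ∧ (g, h) ∈ L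

theorem meets_conjSub (c : SymThree × SymThree) (L : Subgroup (SymThree × SymThree))
    (p q : Fin 3) : Meets (conjSub c L) p q ↔ Meets L p q := by
  have key : ∀ c L, Meets (conjSub c L) p q → Meets L p q := by
    rintro c L ⟨g, h, hg, hh, hL⟩
    rw [mem_conjSub] at hL
    exact ⟨c.1⁻¹ * g * c.1, c.2⁻¹ * h * c.2, by rw [permClass_conj, hg],
      by rw [permClass_conj, hh], hL⟩
  refine ⟨key c L, fun h => key c⁻¹ _ ?_⟩
  rwa [conjSub_conjSub, inv_mul_cancel, conjSub_one]

/-- The index of the class of a subgroup `L` of `S₃ × S₃`, determined by which of the products of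
conjugacy classes (three-cycles, `1`), (`1`, three-cycles), (three-cycles, three-cycles),
(transpositions, `1`), (`1`, transpositions), (transpositions, transpositions) it meets. The first
three describe `L ∩ (A₃ × A₃)`, the others the image of `L` under the pair of signs. -/
def indexOfMeets (n₁ n₂ n₃ e₁ e₂ e₃ : Bool) : ℕ :=
  if n₃ && !n₁ then 20 + e₃.toNat
  else if e₃ && !e₁ then 16 + (2 * n₁.toNat + n₂.toNat)
  else 4 * (2 * n₁.toNat + e₁.toNat) + (2 * n₂.toNat + e₂.toNat)

open Classical in
/-- The index of the class of a subgroup of `S₃ × S₃`. -/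
noncomputable def relIndex (L : Subgroup (SymThree × SymThree)) : ℕ :=
  indexOfMeets (decide (Meets L 2 0)) (decide (Meets L 0 2)) (decide (Meets L 2 2))
    (decide (Meets L 1 0)) (decide (Meets L 0 1)) (decide (Meets L 1 1))

theorem relIndex_conjSub (c : SymThree × SymThree) (L : Subgroup (SymThree × SymThree)) :
    relIndex (conjSub c L) = relIndex L := by
  have h : Meets (conjSub c L) = Meets L := by
    ext p q
    exact meets_conjSub c L p q
  unfold relIndex
  rw [h]

theorem meets_symThreePairSub (i : Fin 22) (p q : Fin 3) :
    Meets (symThreePairSub i) p q ↔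
      ∃ g h, codeClass g = p ∧ codeClass h = q ∧ memPairCode i g h = true := by
  simp only [Meets, permOfCode_bijective.2.exists, permClass_permOfCode,
    permOfCode_mem_symThreePairSub]

theorem relIndex_symThreePairSub (i : Fin 22) : relIndex (symThreePairSub i) = i := by
  simp only [relIndex, meets_symThreePairSub]
  have key : ∀ i : Fin 22,
      let m : Fin 3 → Fin 3 → Bool := fun p q =>
        decide (∃ g h, codeClass g = p ∧ codeClass h = q ∧ memPairCode i g h = true)
      indexOfMeets (m 2 0) (m 0 2) (m 2 2) (m 1 0) (m 0 1) (m 1 1) = i := by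
    decide +kernel
  convert key i

/-! ### Sets of permutations as bit masks -/

/-- A number below `2 ^ 6` encodes a set of permutations through its binary digits. -/
def IsMask (m : ℕ) (S : SymThree → Prop) : Prop :=
  m < 64 ∧ ∀ h : Fin 6, m.testBit h = true ↔ S (permOfCode h)

/-- Whether the sets encoded by two masks meet. -/
def maskMeets (m m' : ℕ) : Bool := Nat.ble 1 (m &&& m')

theorem maskMeets_iff {m m' : ℕ} {S S' : SymThree → Prop} (h : IsMask m S) (h' : IsMask m' S') :
    maskMeets m m' = true ↔ ∃ x, S x ∧ S' x := by
  rw [maskMeets, Nat.ble_eq, Nat.one_le_iff_ne_zero, permOfCode_bijective.2.exists]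
  constructor
  · intro hm
    obtain ⟨k, hk⟩ := Nat.exists_testBit_of_ne_zero hm
    rw [Nat.testBit_and, Bool.and_eq_true] at hk
    have hk6 : k < 6 := by
      by_contra hc
      rw [Nat.testBit_lt_two_pow (h.1.trans_le (Nat.pow_le_pow_right two_pos (not_lt.1 hc)))] at hk
      exact Bool.noConfusion hk.1
    exact ⟨⟨k, hk6⟩, (h.2 ⟨k, hk6⟩).1 hk.1, (h'.2 ⟨k, hk6⟩).1 hk.2⟩
  · rintro ⟨k, h1, h2⟩ h0
    have : (m &&& m').testBit k = true := by
      rw [Nat.testBit_and, (h.2 k).2 h1, (h'.2 k).2 h2, Bool.and_self]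
    rw [h0, Nat.zero_testBit] at this
    exact Bool.noConfusion this

/-- A binary digit. -/
def bit (m h : ℕ) : ℕ := m / 2 ^ h % 2

/-- The number of elements of the set encoded by a mask. -/
def maskCard (m : ℕ) : ℕ := bit m 0 + bit m 1 + bit m 2 + bit m 3 + bit m 4 + bit m 5

theorem maskCard_and {m m' : ℕ} {S S' : SymThree → Prop} (h : IsMask m S) (h' : IsMask m' S') :
    maskCard (m &&& m') = Nat.card {x // S x ∧ S' x} := by
  have key : ∀ m < 64, maskCard m = Fintype.card {k : Fin 6 // m.testBit k = true} := by
    decide +kernel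
  rw [key _ (Nat.and_lt_two_pow m (n := 6) h'.1), ← Nat.card_eq_fintype_card]
  refine Nat.card_congr (Equiv.subtypeEquiv (Equiv.ofBijective _ permOfCode_bijective) fun k => ?_)
  rw [Nat.testBit_and, Bool.and_eq_true, h.2, h'.2]
  rfl

/-- The mask of the conjugate of a set by the permutation with number `a`. -/
def maskConj (a m : ℕ) : ℕ :=
  bit m (codeConj a 0) + 2 * bit m (codeConj a 1) + 4 * bit m (codeConj a 2) +
    8 * bit m (codeConj a 3) + 16 * bit m (codeConj a 4) + 32 * bit m (codeConj a 5)

theorem IsMask.maskConj {m : ℕ} {S : SymThree → Prop} (h : IsMask m S) (a : Fin 6) :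
    IsMask (maskConj a m) fun x => S ((permOfCode a)⁻¹ * x * permOfCode a) := by
  have key : ∀ a : Fin 6, ∀ m < 64, _root_.maskConj a m < 64 ∧
      ∀ h : Fin 6, (_root_.maskConj a m).testBit h = m.testBit (codeConj a h) := by
    decide +kernel
  refine ⟨(key a m h.1).1, fun k => ?_⟩
  obtain ⟨k', hk, hk'⟩ := exists_permOfCode_conj a k
  rw [(key a m h.1).2, hk, h.2]
  exact iff_of_eq (congrArg S hk'.symm)

/-- For the subgroup with index `i`, the masks of the sets of all `h` such that `(g, h)` belongs to
the subgroup for some `g` in the conjugacy class `0`, `1`, `2`, respectively. -/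
def leftRow (i : ℕ) : ℕ × ℕ × ℕ :=
  ([(1, 0, 0), (9, 0, 0), (7, 0, 0), (63, 0, 0), (1, 1, 0), (9, 9, 0), (7, 7, 0), (63, 63, 0),
    (1, 0, 1), (9, 0, 9), (7, 0, 7), (63, 0, 63), (1, 1, 1), (9, 9, 9), (7, 7, 7), (63, 63, 63),
    (1, 8, 0), (7, 56, 0), (1, 8, 1), (7, 56, 7), (1, 0, 6), (1, 56, 6)] :
    List (ℕ × ℕ × ℕ)).getD i 0

/-- For the subgroup with index `i`, the masks of the sets of all `h` such that `(h, g)` belongs to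
the subgroup for some `g` in the conjugacy class `0`, `1`, `2`, respectively. -/
def rightRow (i : ℕ) : ℕ × ℕ × ℕ :=
  ([(1, 0, 0), (1, 1, 0), (1, 0, 1), (1, 1, 1), (9, 0, 0), (9, 9, 0), (9, 0, 9), (9, 9, 9),
    (7, 0, 0), (7, 7, 0), (7, 0, 7), (7, 7, 7), (63, 0, 0), (63, 63, 0), (63, 0, 63),
    (63, 63, 63), (1, 8, 0), (1, 8, 1), (7, 56, 0), (7, 56, 7), (1, 0, 6), (1, 56, 6)] :
    List (ℕ × ℕ × ℕ)).getD i 0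

/-- The entry of a triple with the given position. -/
def entry (r : ℕ × ℕ × ℕ) (p : Fin 3) : ℕ := if p = 0 then r.1 else if p = 1 then r.2.1 else r.2.2

theorem isMask_leftRow (i : Fin 22) (p : Fin 3) : IsMask (entry (leftRow i) p)
    fun h => ∃ g, permClass g = p ∧ (g, h) ∈ symThreePairSub i := by
  have key : ∀ i : Fin 22, ∀ p, entry (leftRow i) p < 64 ∧ ∀ h : Fin 6,
      (entry (leftRow i) p).testBit h = true ↔
        ∃ g, codeClass g = p ∧ memPairCode i g h = true := by
    decide +kernel
  refine ⟨(key i p).1, fun h => ((key i p).2 h).trans ?_⟩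
  simp only [permOfCode_bijective.2.exists, permClass_permOfCode, permOfCode_mem_symThreePairSub]

theorem isMask_rightRow (i : Fin 22) (p : Fin 3) : IsMask (entry (rightRow i) p)
    fun h => ∃ g, permClass g = p ∧ (h, g) ∈ symThreePairSub i := by
  have key : ∀ i : Fin 22, ∀ p, entry (rightRow i) p < 64 ∧ ∀ h : Fin 6,
      (entry (rightRow i) p).testBit h = true ↔
        ∃ g, codeClass g = p ∧ memPairCode i h g = true := by
    decide +kernel
  refine ⟨(key i p).1, fun h => ((key i p).2 h).trans ?_⟩
  simp only [permOfCode_bijective.2.exists, permClass_permOfCode, permOfCode_mem_symThreePairSub]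

theorem meets_relComp_iff (i j : Fin 22) (a : Fin 6) (p q : Fin 3) :
    Meets (relComp (symThreePairSub i) (conjSub (permOfCode a, 1) (symThreePairSub j))) p q ↔
      maskMeets (entry (leftRow i) p) (maskConj a (entry (rightRow j) q)) = true := by
  rw [maskMeets_iff (isMask_leftRow i p) ((isMask_rightRow j q).maskConj a)]
  constructor
  · rintro ⟨g, k, hg, hk, h, h1, h2⟩
    refine ⟨h, ⟨g, hg, h1⟩, k, hk, ?_⟩
    simpa [mem_conjSub] using h2
  · rintro ⟨h, ⟨g, hg, h1⟩, k, hk, h2⟩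
    refine ⟨g, k, hg, hk, h, h1, ?_⟩
    simpa [mem_conjSub] using h2

theorem middleCard_symThreePairSub (i j : Fin 22) (a : Fin 6) :
    middleCard (symThreePairSub i) (conjSub (permOfCode a, 1) (symThreePairSub j)) =
      maskCard (entry (leftRow i) 0 &&& maskConj a (entry (rightRow j) 0)) := by
  rw [maskCard_and (isMask_leftRow i 0) ((isMask_rightRow j 0).maskConj a)]
  have hone : ∀ x, permClass x = 0 ↔ x = 1 := by decide +kernel
  refine Nat.card_congr (Equiv.subtypeEquiv (Equiv.refl _) fun h => ?_)
  simp [hone, mem_conjSub]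

/-! ### The coordinates dual to the second basis -/

/-- The rows of the modified table of marks, each multiplied by the order of the subgroup to which
it belongs. Zeros at the end of a row are omitted. -/
def scaledMarks : List (List ℕ) :=
  [[6], [6, 2], [6, 0, 6], [6, 6, 6, 6], [6, 0, 0, 0, 6], [6, 2, 0, 0, 6, 2],
    [6, 0, 6, 0, 6, 0, 6], [6, 6, 6, 6, 6, 6, 6, 6], [6, 0, 0, 0, 0, 0, 0, 0, 12],
    [6, 2, 0, 0, 0, 0, 0, 0, 12, 4], [6, 0, 6, 0, 0, 0, 0, 0, 12, 0, 12],
    [6, 6, 6, 6, 0, 0, 0, 0, 12, 12, 12, 12], [6, 0, 0, 0, 18, 0, 0, 0, 12, 0, 0, 0, 36],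
    [6, 2, 0, 0, 18, 6, 0, 0, 12, 4, 0, 0, 36, 12],
    [6, 0, 6, 0, 18, 0, 18, 0, 12, 0, 12, 0, 36, 0, 36],
    [6, 6, 6, 6, 18, 18, 18, 18, 12, 12, 12, 12, 36, 36, 36, 36],
    [6, 0, 0, 0, 0, 2, 0, 0, 0, 0, 0, 0, 0, 0, 0, 0, 2],
    [6, 0, 6, 0, 0, 6, 0, 6, 0, 0, 0, 0, 0, 0, 0, 0, 6, 6],
    [6, 0, 0, 0, 0, 6, 0, 0, 12, 0, 0, 0, 0, 12, 0, 0, 6, 0, 12],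
    [6, 0, 6, 0, 0, 18, 0, 18, 12, 0, 12, 0, 0, 36, 0, 36, 18, 18, 36, 36],
    [6, 0, 0, 0, 0, 0, 0, 0, 0, 0, 6, 0, 0, 0, 0, 0, 0, 0, 0, 0, 6],
    [6, 0, 0, 0, 0, 6, 0, 0, 0, 0, 6, 0, 0, 0, 0, 0, 6, 0, 0, 0, 6, 6]]

/-- An entry of `scaledMarks`. -/
def scaledMark (i k : ℕ) : ℕ := (scaledMarks.getD i []).getD k 0

theorem scaledMark_eq (i k : Fin 22) :
    (scaledMark i k : ℚ) = pairSubCard i * modifiedMarks i k := by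
  revert i k
  decide +kernel

/-- The linear form on `ℚB(S₃, S₃)` which takes the coordinate of the element with index `k` of the
second basis. A transitive biset with point stabilizer `L` has `36 / |L|` points, which accounts for
the denominator and for the factor `|L|` in `scaledMarks`. -/
noncomputable def coordForm (k : ℕ) : RatDoubleBurnside SymThree →ₗ[ℚ] ℚ :=
  stabForm fun L => (scaledMark (relIndex L) k : ℚ) / 36

theorem pairSubCard_ne_zero (i : Fin 22) : (pairSubCard i : ℚ) ≠ 0 := by
  rw [← card_symThreePairSub]
  exact Nat.cast_ne_zero.2 Nat.card_pos.ne'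

theorem card_symThree : Nat.card SymThree = 6 := by
  rw [Nat.card_eq_fintype_card]
  rfl

theorem pairSubCard_mul_coordForm (i : Fin 22) (k : ℕ) :
    pairSubCard i * coordForm k (transitiveClass (symThreePairSub i)) = scaledMark i k := by
  rw [← card_symThreePairSub, coordForm, stabForm_transitiveClass _
    (fun c L => by rw [relIndex_conjSub]), relIndex_symThreePairSub, card_symThree]
  norm_num
  ring

theorem coordForm_transitiveClass (i k : Fin 22) :
    coordForm k (transitiveClass (symThreePairSub i)) = modifiedMarks i k :=
  mul_left_cancel₀ (pairSubCard_ne_zero i)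
    ((pairSubCard_mul_coordForm i k).trans (scaledMark_eq i k))

/-! ### The multiplication table of the second basis -/

/-- The coordinates of a product. The elements with indices `4 p + q`, where `p, q < 4`, behave like
matrix units, except that the product through the index `3` vanishes; so do those with indices
`16 + 2 p + q`, where `p, q < 2`, for which the product through the index `1` vanishes. The element
with index `21` acts as the identity on the last row and the last column of either block, and the
elements with indices `20` and `21` are idempotent. -/
def prodCoord {R : Type} [Semiring R] (x y : ℕ → R) (k : ℕ) : R :=
  if k < 16 then
    x (4 * (k / 4)) * y (k % 4) + x (4 * (k / 4) + 1) * y (4 + k % 4) +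
      x (4 * (k / 4) + 2) * y (8 + k % 4) + (if k / 4 = 3 then x 21 * y k else 0) +
      (if k % 4 = 3 then x k * y 21 else 0)
  else if k < 20 then
    x (16 + 2 * (k / 2 - 8)) * y (16 + k % 2) + (if k / 2 = 9 then x 21 * y k else 0) +
      (if k % 2 = 1 then x k * y 21 else 0)
  else x k * y k

/-- Application of a function to a natural number. By the case distinction the argument is evaluated
once, before it is substituted. -/
def force {α : Type} (x : ℕ) (f : ℕ → α) : α :=
  match x with
  | 0 => f 0
  | n + 1 => f (n + 1)

theorem force_eq {α : Type} (x : ℕ) (f : ℕ → α) : force x f = f x := by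
  cases x <;> rfl

/-- Application of a function to a list of natural numbers, with evaluated entries. -/
def forceList {α : Type} : List ℕ → (List ℕ → α) → α
  | [], f => f []
  | x :: xs, f => force x fun y => forceList xs fun ys => f (y :: ys)

theorem forceList_eq {α : Type} (l : List ℕ) (f : List ℕ → α) : forceList l f = f l := by
  induction l generalizing f with
  | nil => rfl
  | cons x xs ih => rw [forceList, force_eq, ih]

/-- Application of a function to an evaluated triple. -/
def forceTriple {α : Type} (r : ℕ × ℕ × ℕ) (f : ℕ × ℕ × ℕ → α) : α :=
  match r with
  | (a, b, c) => f (a, b, c)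

theorem forceTriple_eq {α : Type} (r : ℕ × ℕ × ℕ) (f : ℕ × ℕ × ℕ → α) : forceTriple r f = f r := rfl

/-- For `u = leftRow i`, `v = rightRow j` and `Lⱼᵃ` the conjugate by the permutation with number
`a` on the left, the number `32 * m + n`, where `m` is the middle cardinality of `Lᵢ` and `Lⱼᵃ`, and
`n < 32` is the index of their composition. -/
def compCode (u v : ℕ × ℕ × ℕ) (a : ℕ) : ℕ :=
  force (maskConj a v.1) fun v₀ => force (maskConj a v.2.1) fun v₁ =>
    force (maskConj a v.2.2) fun v₂ =>
      32 * maskCard (u.1 &&& v₀) +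
        indexOfMeets (maskMeets u.2.2 v₀) (maskMeets u.1 v₂) (maskMeets u.2.2 v₂)
          (maskMeets u.2.1 v₀) (maskMeets u.1 v₁) (maskMeets u.2.1 v₁)

theorem indexOfMeets_lt (n₁ n₂ n₃ e₁ e₂ e₃ : Bool) : indexOfMeets n₁ n₂ n₃ e₁ e₂ e₃ < 32 := by
  revert n₁ n₂ n₃ e₁ e₂ e₃
  decide +kernel

theorem relIndex_relComp (i j : Fin 22) (a : Fin 6) :
    relIndex (relComp (symThreePairSub i) (conjSub (permOfCode a, 1) (symThreePairSub j))) =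
      compCode (leftRow i) (rightRow j) a % 32 := by
  simp only [compCode, force_eq]
  rw [Nat.mul_add_mod, Nat.mod_eq_of_lt (indexOfMeets_lt _ _ _ _ _ _), relIndex]
  simp only [meets_relComp_iff, entry, Bool.decide_eq_true]
  rfl

theorem middleCard_eq (i j : Fin 22) (a : Fin 6) :
    middleCard (symThreePairSub i) (conjSub (permOfCode a, 1) (symThreePairSub j)) =
      compCode (leftRow i) (rightRow j) a / 32 := by
  simp only [compCode, force_eq]
  rw [Nat.mul_add_div (by norm_num), Nat.div_eq_of_lt (indexOfMeets_lt _ _ _ _ _ _), add_zero,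
    middleCard_symThreePairSub]
  rfl

/-- Comparison of the Mackey formula with `prodCoord` for the subgroups with indices `i` and `j`. -/
def checkProd (i j : ℕ) : Bool :=
  forceTriple (leftRow i) fun u => forceTriple (rightRow j) fun v =>
    forceList ([0, 1, 2, 3, 4, 5].map (compCode u v)) fun l =>
      (List.range 22).all fun k =>
        Nat.beq (l.map fun c => c / 32 * scaledMark (c % 32) k).sum
          (prodCoord (scaledMark i) (scaledMark j) k)

theorem checkProd_eq_true : ∀ i < 22, ∀ j < 22, checkProd i j = true := by
  decide +kernel

theorem sum_middleCard_mul_scaledMark (i j k : Fin 22) :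
    ∑ a : SymThree, middleCard (symThreePairSub i) (conjSub (a, 1) (symThreePairSub j)) *
      scaledMark (relIndex (relComp (symThreePairSub i) (conjSub (a, 1) (symThreePairSub j)))) k =
      prodCoord (scaledMark i) (scaledMark j) k := by
  have h := checkProd_eq_true i i.2 j j.2
  rw [checkProd, forceTriple_eq, forceTriple_eq, forceList_eq, List.all_eq_true] at h
  rw [← Nat.eq_of_beq_eq_true (h k (List.mem_range.2 k.2)),
    ← (Equiv.ofBijective _ permOfCode_bijective).sum_comp]
  simp only [Equiv.ofBijective_apply, middleCard_eq, relIndex_relComp, Fin.sum_univ_six, List.map,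
    List.sum_cons, List.sum_nil, Fin.val_zero, Fin.val_one, Fin.val_two]
  simp only [← add_assoc, add_zero]
  rfl

theorem coordForm_transitiveClass_mul (i j k : Fin 22) :
    coordForm k (transitiveClass (symThreePairSub i) * transitiveClass (symThreePairSub j)) =
      prodCoord (fun n => coordForm n (transitiveClass (symThreePairSub i)))
        (fun n => coordForm n (transitiveClass (symThreePairSub j))) k := by
  refine mul_left_cancel₀ (mul_ne_zero (pairSubCard_ne_zero i) (pairSubCard_ne_zero j)) ?_
  have hsum := congrArg (Nat.cast : ℕ → ℚ) (sum_middleCard_mul_scaledMark i j k)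
  have hcast : ((prodCoord (scaledMark i) (scaledMark j) k : ℕ) : ℚ) =
      prodCoord (fun n => (scaledMark i n : ℚ)) (fun n => (scaledMark j n : ℚ)) k := by
    simp only [prodCoord]
    split_ifs <;> push_cast <;> rfl
  have hhom : ∀ (s s' : ℚ) (x y : ℕ → ℚ),
      prodCoord (fun n => s * x n) (fun n => s' * y n) k = s * s' * prodCoord x y k := by
    intro s s' x y
    simp only [prodCoord]
    split_ifs <;> ring
  rw [← hhom]
  simp only [pairSubCard_mul_coordForm]
  rw [← card_symThreePairSub, ← card_symThreePairSub, coordForm,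
    stabForm_transitiveClass_mul _ (fun c L => by rw [relIndex_conjSub]), ← hcast, ← hsum,
    card_symThree]
  push_cast
  rw [Finset.mul_sum]
  refine Finset.sum_congr rfl fun a _ => ?_
  ring

/-- The multiplication table of the second basis in terms of coordinates. -/
theorem coordForm_mul
    (hspan : Submodule.span ℚ (Set.range fun i => transitiveClass (symThreePairSub i)) = ⊤)
    (k : Fin 22) (x y : RatDoubleBurnside SymThree) :
    coordForm k (x * y) = prodCoord (fun n => coordForm n x) (fun n => coordForm n y) k := by
  have hadd : ∀ (x x' y : ℕ → ℚ), prodCoord (fun n => x n + x' n) y k =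
      prodCoord x y k + prodCoord x' y k := by
    intro x x' y
    simp only [prodCoord]
    split_ifs <;> ring
  have hadd' : ∀ (x y y' : ℕ → ℚ), prodCoord x (fun n => y n + y' n) k =
      prodCoord x y k + prodCoord x y' k := by
    intro x x' y
    simp only [prodCoord]
    split_ifs <;> ring
  have hsmul : ∀ (s : ℚ) (x y : ℕ → ℚ), prodCoord (fun n => s * x n) y k =
      s * prodCoord x y k := by
    intro s x y
    simp only [prodCoord]
    split_ifs <;> ring
  have hsmul' : ∀ (s : ℚ) (x y : ℕ → ℚ), prodCoord x (fun n => s * y n) k =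
      s * prodCoord x y k := by
    intro s x y
    simp only [prodCoord]
    split_ifs <;> ring
  have hzero : ∀ y : ℕ → ℚ, prodCoord (fun _ => 0) y k = 0 := by
    intro y
    simp [prodCoord]
  have hzero' : ∀ y : ℕ → ℚ, prodCoord y (fun _ => 0) k = 0 := by
    intro y
    simp [prodCoord]
  have hx : x ∈ Submodule.span ℚ (Set.range fun i => transitiveClass (symThreePairSub i)) :=
    hspan ▸ Submodule.mem_top
  have hy : y ∈ Submodule.span ℚ (Set.range fun i => transitiveClass (symThreePairSub i)) :=
    hspan ▸ Submodule.mem_top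
  induction hx, hy using Submodule.span_induction₂ with
  | mem_mem x y hx hy =>
    obtain ⟨i, rfl⟩ := hx
    obtain ⟨j, rfl⟩ := hy
    exact coordForm_transitiveClass_mul i j k
  | zero_left y _ => simp only [zero_mul, map_zero, hzero]
  | zero_right x _ => simp only [mul_zero, map_zero, hzero']
  | add_left x y z _ _ _ h1 h2 => simp only [add_mul, map_add, hadd, h1, h2]
  | add_right x y z _ _ _ h1 h2 => simp only [mul_add, map_add, hadd', h1, h2]
  | smul_left r x y _ _ h => simp only [smul_mul_assoc, map_smul, smul_eq_mul, hsmul, h]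
  | smul_right r x y _ _ h => simp only [mul_smul_comm, map_smul, smul_eq_mul, hsmul', h]

/-! ### Classification of the subgroups of `S₃ × S₃` up to conjugacy -/

/-- A subgroup of `S₃ × S₃` is standard if its pairs of signs are realized by pairs of elements of
the fixed subgroup of order two. -/
def IsStandard (L : Subgroup (SymThree × SymThree)) : Prop :=
  ∀ g h : Fin 6, (permOfCode g, permOfCode h) ∈ L →
    (permOfCode (if g < 3 then 0 else 3), permOfCode (if h < 3 then 0 else 3)) ∈ L

theorem exists_isStandard_conjSub (L : Subgroup (SymThree × SymThree)) :
    ∃ c, IsStandard (conjSub c L) := by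
  have heven : ∀ x : SymThree, Equiv.Perm.sign x = 1 → x ^ 3 = 1 := by decide +kernel
  have hodd : ∀ x : SymThree, Equiv.Perm.sign x ≠ 1 → x ^ 3 = x := by decide +kernel
  have hmul : ∀ x y : SymThree, Equiv.Perm.sign x ≠ 1 → Equiv.Perm.sign y ≠ 1 →
      Equiv.Perm.sign (x * y) = 1 := by decide +kernel
  have ht : Equiv.Perm.sign (permOfCode 3) ≠ 1 := by decide +kernel
  -- Cubing turns an element of `L` with signs `(-1, 1)` into `(s, 1)` with a transposition `s`.
  have key : ∃ s s', Equiv.Perm.sign s ≠ 1 ∧ Equiv.Perm.sign s' ≠ 1 ∧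
      ∀ x y, (x, y) ∈ L → (if Equiv.Perm.sign x = 1 then 1 else s,
        if Equiv.Perm.sign y = 1 then 1 else s') ∈ L := by
    by_cases hA : ∃ s, Equiv.Perm.sign s ≠ 1 ∧ (s, 1) ∈ L <;>
    by_cases hB : ∃ s', Equiv.Perm.sign s' ≠ 1 ∧ (1, s') ∈ L
    · obtain ⟨s, hs, hsL⟩ := hA
      obtain ⟨s', hs', hsL'⟩ := hB
      refine ⟨s, s', hs, hs', fun x y _ => ?_⟩
      split_ifs
      · exact L.one_mem
      · exact hsL'
      · exact hsL
      · simpa using L.mul_mem hsL hsL'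
    all_goals
      have hA' : ∀ x y, (x, y) ∈ L → Equiv.Perm.sign x ≠ 1 → Equiv.Perm.sign y = 1 →
          (x, 1) ∈ L := fun x y h hx hy => by
        simpa [hodd x hx, heven y hy] using L.pow_mem h 3
      have hB' : ∀ x y, (x, y) ∈ L → Equiv.Perm.sign x = 1 → Equiv.Perm.sign y ≠ 1 →
          (1, y) ∈ L := fun x y h hx hy => by
        simpa [heven x hx, hodd y hy] using L.pow_mem h 3
    · obtain ⟨s, hs, hsL⟩ := hA
      refine ⟨s, permOfCode 3, hs, ht, fun x y h => ?_⟩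
      have hy : Equiv.Perm.sign y = 1 := by
        by_contra hy
        by_cases hx : Equiv.Perm.sign x = 1
        · exact hB ⟨y, hy, hB' x y h hx hy⟩
        · exact hB ⟨y, hy, hB' (s * x) y (by simpa using L.mul_mem hsL h) (hmul s x hs hx) hy⟩
      rw [if_pos hy]
      split_ifs
      · exact L.one_mem
      · exact hsL
    · obtain ⟨s', hs', hsL'⟩ := hB
      refine ⟨permOfCode 3, s', ht, hs', fun x y h => ?_⟩
      have hx : Equiv.Perm.sign x = 1 := by
        by_contra hx
        by_cases hy : Equiv.Perm.sign y = 1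
        · exact hA ⟨x, hx, hA' x y h hx hy⟩
        · exact hA ⟨x, hx, hA' x (s' * y) (by simpa using L.mul_mem hsL' h) hx (hmul s' y hs' hy)⟩
      rw [if_pos hx]
      split_ifs
      · exact L.one_mem
      · exact hsL'
    · have hxy : ∀ x y, (x, y) ∈ L → (Equiv.Perm.sign x = 1 ↔ Equiv.Perm.sign y = 1) := by
        refine fun x y h => ⟨fun hx => ?_, fun hy => ?_⟩
        · by_contra hy
          exact hB ⟨y, hy, hB' x y h hx hy⟩
        · by_contra hx
          exact hA ⟨x, hx, hA' x y h hx hy⟩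
      by_cases hD : ∃ s s', (s, s') ∈ L ∧ Equiv.Perm.sign s ≠ 1
      · obtain ⟨s, s', hL, hs⟩ := hD
        refine ⟨s, s', hs, fun h => hs ((hxy s s' hL).2 h), fun x y h => ?_⟩
        by_cases hx : Equiv.Perm.sign x = 1
        · rw [if_pos hx, if_pos ((hxy x y h).1 hx)]
          exact L.one_mem
        · rw [if_neg hx, if_neg (fun hy => hx ((hxy x y h).2 hy))]
          exact hL
      · refine ⟨permOfCode 3, permOfCode 3, ht, ht, fun x y h => ?_⟩
        have hx : Equiv.Perm.sign x = 1 := by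
          by_contra hx
          exact hD ⟨x, y, h, hx⟩
        rw [if_pos hx, if_pos ((hxy x y h).1 hx)]
        exact L.one_mem
  obtain ⟨s, s', hs, hs', hL⟩ := key
  have hconj : ∀ s : SymThree, Equiv.Perm.sign s ≠ 1 → ∃ a, a⁻¹ * permOfCode 3 * a = s := by
    decide +kernel
  have hstd : ∀ a : SymThree, ∀ g : Fin 6, a⁻¹ * permOfCode (if g < 3 then 0 else 3) * a =
      if Equiv.Perm.sign (a⁻¹ * permOfCode g * a) = 1 then 1 else a⁻¹ * permOfCode 3 * a := by
    decide +kernel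
  obtain ⟨a, rfl⟩ := hconj s hs
  obtain ⟨b, rfl⟩ := hconj s' hs'
  refine ⟨(a, b), fun g h hgh => ?_⟩
  have hmem : ∀ x y, (x, y) ∈ conjSub (a, b) L ↔ (a⁻¹ * x * a, b⁻¹ * y * b) ∈ L :=
    fun x y => mem_conjSub
  rw [hmem] at hgh ⊢
  rw [hstd, hstd]
  exact hL _ _ hgh

/-- Membership in a standard subgroup, in terms of the membership of `(r, 1)`, `(1, r)`, `(r, r)`,
`(r, r²)`, `(t, 1)`, `(1, t)` and `(t, t)`. -/
def standardMem (n₁ n₂ n₃ n₄ e₁ e₂ e₃ : Bool) (g h : Fin 6) : Bool :=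
  (if g.val % 3 = 0 then (if h.val % 3 = 0 then true else n₂)
    else if h.val % 3 = 0 then n₁ else if g.val % 3 = h.val % 3 then n₃ else n₄) &&
  (if g < 3 then (if h < 3 then true else e₂) else if h < 3 then e₁ else e₃)

/-- The relations between the seven memberships in `standardMem` which hold for a subgroup: two of
the first four imply the others, two of the last three imply the third, and conjugation by `(t, 1)`
or `(1, t)` exchanges the third and the fourth. -/
def standardConsistent (n₁ n₂ n₃ n₄ e₁ e₂ e₃ : Bool) : Bool :=
  decide ((n₁ → n₂ → n₃ ∧ n₄) ∧ (n₁ → n₃ → n₂) ∧ (n₁ → n₄ → n₂) ∧ (n₂ → n₃ → n₁) ∧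
    (n₂ → n₄ → n₁) ∧ (n₃ → n₄ → n₁) ∧ (e₁ → e₂ → e₃) ∧ (e₁ → e₃ → e₂) ∧ (e₂ → e₃ → e₁) ∧
    (n₃ → e₁ → n₄) ∧ (n₃ → e₂ → n₄) ∧ (n₄ → e₁ → n₃) ∧ (n₄ → e₂ → n₃))

/-- The consistent choices of the seven memberships give exactly the subgroups `L₁, …, L₂₂` and, for
those meeting `A₃ × A₃` in the graph of the inversion, their conjugates by `(1, t)`. -/
theorem exists_standardMem_eq : ∀ n₁ n₂ n₃ n₄ e₁ e₂ e₃ : Bool,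
    standardConsistent n₁ n₂ n₃ n₄ e₁ e₂ e₃ = true →
    ∃ i : Fin 22, ∃ a : Fin 6, ∀ g h k : Fin 6, codeConj a h = k →
      standardMem n₁ n₂ n₃ n₄ e₁ e₂ e₃ g h = memPairCode i g k := by
  decide +kernel

theorem IsStandard.exists_eq_conjSub {L : Subgroup (SymThree × SymThree)} (hL : IsStandard L) :
    ∃ i c, L = conjSub c (symThreePairSub i) := by
  classical
  obtain ⟨M, hM⟩ : ∃ M : Fin 6 → Fin 6 → Prop, ∀ g h, M g h ↔ (permOfCode g, permOfCode h) ∈ L :=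
    ⟨_, fun _ _ => Iff.rfl⟩
  have mul : ∀ {g h g' h' : Fin 6} (k l : Fin 6), M g h → M g' h' →
      permOfCode g * permOfCode g' = permOfCode k →
      permOfCode h * permOfCode h' = permOfCode l → M k l := by
    intro g h g' h' k l h1 h2 h3 h4
    rw [hM] at h1 h2 ⊢
    rw [← h3, ← h4]
    exact L.mul_mem h1 h2
  have e11 : permOfCode 1 * permOfCode 1 = permOfCode 2 := by decide +kernel
  have e12 : permOfCode 1 * permOfCode 2 = permOfCode 0 := by decide +kernel
  have e21 : permOfCode 2 * permOfCode 1 = permOfCode 0 := by decide +kernel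
  have e22 : permOfCode 2 * permOfCode 2 = permOfCode 1 := by decide +kernel
  have e31 : permOfCode 3 * permOfCode 1 = permOfCode 5 := by decide +kernel
  have e32 : permOfCode 3 * permOfCode 2 = permOfCode 4 := by decide +kernel
  have e33 : permOfCode 3 * permOfCode 3 = permOfCode 0 := by decide +kernel
  have e43 : permOfCode 4 * permOfCode 3 = permOfCode 1 := by decide +kernel
  have e53 : permOfCode 5 * permOfCode 3 = permOfCode 2 := by decide +kernel
  have zl : ∀ g, permOfCode 0 * permOfCode g = permOfCode g := by decide +kernel
  have zr : ∀ g, permOfCode g * permOfCode 0 = permOfCode g := by decide +kernel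
  have inv : ∀ {g h : Fin 6} (k l : Fin 6), M g h → (permOfCode g)⁻¹ = permOfCode k →
      (permOfCode h)⁻¹ = permOfCode l → M k l := by
    intro g h k l h1 h2 h3
    rw [hM] at h1 ⊢
    rw [← h2, ← h3]
    exact L.inv_mem h1
  have m00 : M 0 0 := (hM 0 0).2 L.one_mem
  -- Squaring permutes the two nontrivial rotations, so that four memberships determine
  -- the intersection with `A₃ × A₃`.
  have m20 : M 2 0 ↔ M 1 0 := ⟨fun h => mul 1 0 h h e22 (zl 0), fun h => mul 2 0 h h e11 (zl 0)⟩
  have m02 : M 0 2 ↔ M 0 1 := ⟨fun h => mul 0 1 h h (zl 0) e22, fun h => mul 0 2 h h (zl 0) e11⟩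
  have m22 : M 2 2 ↔ M 1 1 := ⟨fun h => mul 1 1 h h e22 e22, fun h => mul 2 2 h h e11 e11⟩
  have m21 : M 2 1 ↔ M 1 2 := ⟨fun h => mul 1 2 h h e22 e11, fun h => mul 2 1 h h e11 e22⟩
  have c1 : M 1 0 → M 0 1 → M 1 1 := fun h1 h2 => mul 1 1 h1 h2 (zr 1) (zl 1)
  have c2 : M 1 0 → M 0 1 → M 1 2 := fun h1 h2 => mul 1 2 h1 (m02.2 h2) (zr 1) (zl 2)
  have c3 : M 1 0 → M 1 1 → M 0 1 := fun h1 h2 => mul 0 1 (m20.2 h1) h2 e21 (zl 1)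
  have c4 : M 1 0 → M 1 2 → M 0 1 := fun h1 h2 => m02.1 (mul 0 2 (m20.2 h1) h2 e21 (zl 2))
  have c5 : M 0 1 → M 1 1 → M 1 0 := fun h1 h2 => mul 1 0 (m02.2 h1) h2 (zl 1) e21
  have c6 : M 0 1 → M 1 2 → M 1 0 := fun h1 h2 => mul 1 0 h1 h2 (zl 1) e12
  have c7 : M 1 1 → M 1 2 → M 1 0 := fun h1 h2 => m20.1 (mul 2 0 h1 h2 e11 e12)
  have d1 : M 3 0 → M 0 3 → M 3 3 := fun h1 h2 => mul 3 3 h1 h2 (zr 3) (zl 3)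
  have d2 : M 3 0 → M 3 3 → M 0 3 := fun h1 h2 => mul 0 3 h1 h2 e33 (zl 3)
  have d3 : M 0 3 → M 3 3 → M 3 0 := fun h1 h2 => mul 3 0 h1 h2 (zl 3) e33
  have t1 : M 1 1 → M 3 0 → M 1 2 := fun h1 h2 =>
    m21.1 (mul 2 1 (mul 5 1 h2 h1 e31 (zl 1)) h2 e53 (zr 1))
  have t2 : M 1 1 → M 0 3 → M 1 2 := fun h1 h2 =>
    mul 1 2 (mul 1 5 h2 h1 (zl 1) e31) h2 (zr 1) e53
  have t3 : M 1 2 → M 3 0 → M 1 1 := fun h1 h2 =>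
    m22.1 (mul 2 2 (mul 5 2 h2 h1 e31 (zl 2)) h2 e53 (zr 2))
  have t4 : M 1 2 → M 0 3 → M 1 1 := fun h1 h2 =>
    mul 1 1 (mul 1 4 h2 h1 (zl 1) e32) h2 (zr 1) e43
  obtain ⟨i, a, hia⟩ := exists_standardMem_eq (decide (M 1 0)) (decide (M 0 1)) (decide (M 1 1))
    (decide (M 1 2)) (decide (M 3 0)) (decide (M 0 3)) (decide (M 3 3)) (by
      simp only [standardConsistent, decide_eq_true_iff]
      exact ⟨fun h1 h2 => ⟨c1 h1 h2, c2 h1 h2⟩, c3, c4, c5, c6, c7, d1, d2, d3, t1, t2, t3, t4⟩)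
  have hsplit : ∀ g h, M g h ↔ M ⟨g % 3, by omega⟩ ⟨h % 3, by omega⟩ ∧
      M (if g < 3 then 0 else 3) (if h < 3 then 0 else 3) := by
    intro g h
    have hcode : ∀ g : Fin 6, permOfCode ⟨g % 3, by omega⟩ *
        permOfCode (if g < 3 then 0 else 3) = permOfCode g := by decide +kernel
    have hinv : ∀ g : Fin 6, (permOfCode (if g < 3 then 0 else 3))⁻¹ =
        permOfCode (if g < 3 then 0 else 3) := by decide +kernel
    constructor
    · intro hgh
      have h2 : M (if g < 3 then 0 else 3) (if h < 3 then 0 else 3) :=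
        (hM _ _).2 (hL g h ((hM g h).1 hgh))
      refine ⟨mul _ _ hgh (inv _ _ h2 (hinv g) (hinv h)) ?_ ?_, h2⟩
      · rw [← hinv g, mul_inv_eq_iff_eq_mul, hcode]
      · rw [← hinv h, mul_inv_eq_iff_eq_mul, hcode]
    · rintro ⟨h1, h2⟩
      exact mul _ _ h1 h2 (hcode g) (hcode h)
  have hmem : ∀ g h, M g h ↔ standardMem (decide (M 1 0)) (decide (M 0 1)) (decide (M 1 1))
      (decide (M 1 2)) (decide (M 3 0)) (decide (M 0 3)) (decide (M 3 3)) g h = true := by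
    intro g h
    rw [hsplit]
    fin_cases g <;> fin_cases h <;> simp [standardMem, m00, m20, m02, m22, m21]
  refine ⟨i, (1, permOfCode a), Subgroup.ext ?_⟩
  rintro ⟨x, y⟩
  obtain ⟨g, rfl⟩ := permOfCode_bijective.2 x
  obtain ⟨h, rfl⟩ := permOfCode_bijective.2 y
  obtain ⟨k, hk, hk'⟩ := exists_permOfCode_conj a h
  rw [← hM, hmem, hia g h k hk, ← permOfCode_mem_symThreePairSub, mem_conjSub, ← hk']
  simp

theorem exists_eq_conjSub (L : Subgroup (SymThree × SymThree)) :
    ∃ i c, L = conjSub c (symThreePairSub i) := by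
  obtain ⟨c, hc⟩ := exists_isStandard_conjSub L
  obtain ⟨i, d, h⟩ := hc.exists_eq_conjSub
  refine ⟨i, c⁻¹ * d, ?_⟩
  rw [← conjSub_conjSub, ← h, conjSub_conjSub, inv_mul_cancel, conjSub_one]

theorem span_symThreePairSub :
    Submodule.span ℚ (Set.range fun i => transitiveClass (symThreePairSub i)) = ⊤ := by
  rw [← span_transitiveClass]
  congr 1
  ext x
  constructor
  · rintro ⟨i, rfl⟩
    exact ⟨_, rfl⟩
  · rintro ⟨L, rfl⟩
    obtain ⟨i, c, rfl⟩ := exists_eq_conjSub L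
    exact ⟨i, (transitiveClass_conjSub c _).symm⟩

/-! ### The two bases -/

theorem isUnit_modifiedMarks : IsUnit modifiedMarks := by
  have hlower : ∀ p : Fin 22 × Fin 22, p.2 ≤ p.1 ∨ modifiedMarks p.1 p.2 = 0 := by
    decide +kernel
  have hdiag : ∀ i : Fin 22, modifiedMarks i i ≠ 0 := by decide +kernel
  rw [Matrix.isUnit_iff_isUnit_det, Matrix.det_of_isLowerTriangular _ fun i j h =>
    (hlower (i, j)).resolve_left (not_le.2 h), isUnit_iff_ne_zero]
  exact Finset.prod_ne_zero_iff.2 fun i _ => hdiag i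

/-- The coordinates with respect to the second basis. -/
noncomputable def coordMap : RatDoubleBurnside SymThree →ₗ[ℚ] Fin 22 → ℚ :=
  LinearMap.pi fun k => coordForm k

theorem coordMap_apply (x : RatDoubleBurnside SymThree) (k : Fin 22) :
    coordMap x k = coordForm k x := rfl

theorem coordMap_linearCombination (α : Fin 22 → ℚ) :
    coordMap (Fintype.linearCombination ℚ (fun i => transitiveClass (symThreePairSub i)) α) =
      Matrix.vecMul α modifiedMarks := by
  ext k
  simp only [Fintype.linearCombination_apply, map_sum, map_smul, coordMap_apply,
    coordForm_transitiveClass, Matrix.vecMul, dotProduct, smul_eq_mul]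

theorem linearCombination_bijective : Function.Bijective
    (Fintype.linearCombination ℚ fun i => transitiveClass (symThreePairSub i)) := by
  constructor
  · refine Function.Injective.of_comp (f := coordMap) ?_
    intro α β h
    simp only [Function.comp_apply, coordMap_linearCombination] at h
    exact Matrix.vecMul_injective_iff_isUnit.2 isUnit_modifiedMarks h
  · rw [← LinearMap.range_eq_top, Fintype.range_linearCombination, span_symThreePairSub]

theorem coordMap_bijective : Function.Bijective coordMap := by
  have h : Function.Bijective (coordMap ∘
      Fintype.linearCombination ℚ fun i => transitiveClass (symThreePairSub i)) := by
    have : (coordMap ∘ Fintype.linearCombination ℚ fun i => transitiveClass (symThreePairSub i)) =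
        fun α => Matrix.vecMul α modifiedMarks := funext coordMap_linearCombination
    rw [this]
    exact ⟨Matrix.vecMul_injective_iff_isUnit.2 isUnit_modifiedMarks,
      Matrix.vecMul_surjective_iff_isUnit.2 isUnit_modifiedMarks⟩
  exact (Function.Bijective.of_comp_iff _ linearCombination_bijective).1 h

/-- The coordinates with respect to the second basis, as a linear equivalence. -/
noncomputable def coordEquiv : RatDoubleBurnside SymThree ≃ₗ[ℚ] Fin 22 → ℚ :=
  LinearEquiv.ofBijective coordMap coordMap_bijective

theorem coordEquiv_apply (x : RatDoubleBurnside SymThree) (k : Fin 22) :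
    coordEquiv x k = coordForm k x := rfl

theorem eq_of_coordForm_eq {x y : RatDoubleBurnside SymThree}
    (h : ∀ k : Fin 22, coordForm k x = coordForm k y) : x = y :=
  coordEquiv.injective (funext h)

theorem coordForm_coordEquiv_symm (k : ℕ) (hk : k < 22) (v : Fin 22 → ℚ) :
    coordForm k (coordEquiv.symm v) = v ⟨k, hk⟩ := by
  rw [← coordEquiv_apply _ ⟨k, hk⟩, LinearEquiv.apply_symm_apply]

/-- The basis of classes of transitive bisets. -/
noncomputable def transitiveBasis : Module.Basis (Fin 22) ℚ (RatDoubleBurnside SymThree) :=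
  .ofEquivFun (LinearEquiv.ofBijective _ linearCombination_bijective).symm

theorem transitiveBasis_apply (i : Fin 22) :
    transitiveBasis i = transitiveClass (symThreePairSub i) := by
  rw [transitiveBasis, Module.Basis.coe_ofEquivFun]
  simp [Fintype.linearCombination_apply_single]

/-- The basis on which the multiplication is given by `prodCoord`. -/
noncomputable def markBasis : Module.Basis (Fin 22) ℚ (RatDoubleBurnside SymThree) :=
  .ofEquivFun coordEquiv

theorem coordForm_markBasis (i k : Fin 22) :
    coordForm k (markBasis i) = if k = i then 1 else 0 := by
  rw [markBasis, Module.Basis.coe_ofEquivFun, coordForm_coordEquiv_symm k k.2, Pi.single_apply]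

theorem transitiveBasis_eq_sum (i : Fin 22) :
    transitiveBasis i = ∑ j, modifiedMarks i j • markBasis j := by
  refine eq_of_coordForm_eq fun k => ?_
  simp [transitiveBasis_apply, coordForm_transitiveClass, coordForm_markBasis]

/-! ### The Jacobson radical -/

theorem coordForm_mul' (k : ℕ) (hk : k < 22) (x y : RatDoubleBurnside SymThree) :
    coordForm k (x * y) = prodCoord (fun n => coordForm n x) (fun n => coordForm n y) k :=
  coordForm_mul span_symThreePairSub ⟨k, hk⟩ x y

/-- The projection to the semisimple quotient, as a linear map. -/
noncomputable def semisimpleProj : RatDoubleBurnside SymThree →ₗ[ℚ]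
    Matrix (Fin 3) (Fin 3) ℚ × ℚ × ℚ × ℚ where
  toFun x := (Matrix.of fun p q => coordForm (4 * p + q) x, coordForm 16 x, coordForm 20 x,
    coordForm 21 x)
  map_add' x y := by
    simp only [map_add]
    rfl
  map_smul' s x := by
    simp only [map_smul]
    rfl

theorem semisimpleProj_mul (x y : RatDoubleBurnside SymThree) :
    semisimpleProj (x * y) = semisimpleProj x * semisimpleProj y := by
  refine Prod.ext ?_ (Prod.ext ?_ (Prod.ext ?_ ?_))
  · ext p q
    change coordForm (4 * p + q) (x * y) =
      ∑ r : Fin 3, coordForm (4 * p + r) x * coordForm (4 * r + q) y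
    rw [coordForm_mul' _ (by omega)]
    fin_cases p <;> fin_cases q <;> simp [prodCoord, Fin.sum_univ_three]
  all_goals
    refine (coordForm_mul' _ (by norm_num) x y).trans ?_
    simp [prodCoord, semisimpleProj]

theorem semisimpleProj_surjective : Function.Surjective semisimpleProj := by
  rintro ⟨A, u, v, w⟩
  refine ⟨coordEquiv.symm ![A 0 0, A 0 1, A 0 2, 0, A 1 0, A 1 1, A 1 2, 0, A 2 0, A 2 1, A 2 2, 0,
    0, 0, 0, 0, u, 0, 0, 0, v, w], Prod.ext ?_ (Prod.ext ?_ (Prod.ext ?_ ?_))⟩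
  · ext p q
    refine (coordForm_coordEquiv_symm _ (by omega) _).trans ?_
    fin_cases p <;> fin_cases q <;> rfl
  · exact coordForm_coordEquiv_symm 16 (by norm_num) _
  · exact coordForm_coordEquiv_symm 20 (by norm_num) _
  · exact coordForm_coordEquiv_symm 21 (by norm_num) _

/-- The projection to the semisimple quotient. It preserves the identity because it is
multiplicative and surjective. -/
noncomputable def semisimpleHom : RatDoubleBurnside SymThree →ₐ[ℚ]
    Matrix (Fin 3) (Fin 3) ℚ × ℚ × ℚ × ℚ :=
  AlgHom.ofLinearMap semisimpleProj
    (by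
      obtain ⟨x, hx⟩ := semisimpleProj_surjective 1
      rw [← mul_one (semisimpleProj 1), ← hx, ← semisimpleProj_mul, one_mul])
    semisimpleProj_mul

theorem semisimpleHom_surjective : Function.Surjective semisimpleHom :=
  semisimpleProj_surjective

theorem mem_ker_semisimpleHom {x : RatDoubleBurnside SymThree} :
    x ∈ RingHom.ker semisimpleHom ↔ ∀ k : Fin 22,
      (k : ℕ) + 1 ∉ ({4, 8, 12, 13, 14, 15, 16, 18, 19, 20} : Set ℕ) → coordForm k x = 0 := by
  rw [RingHom.mem_ker]
  constructor
  · intro h k hk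
    have h1 : ∀ p q : Fin 3, coordForm (4 * p + q) x = 0 := fun p q =>
      congrFun (congrFun (congrArg Prod.fst h) p) q
    have h2 : coordForm 16 x = 0 := congrArg (fun z => z.2.1) h
    have h3 : coordForm 20 x = 0 := congrArg (fun z => z.2.2.1) h
    have h4 : coordForm 21 x = 0 := congrArg (fun z => z.2.2.2) h
    fin_cases k <;> first
      | assumption
      | exact h1 0 0
      | exact h1 0 1
      | exact h1 0 2
      | exact h1 1 0
      | exact h1 1 1
      | exact h1 1 2
      | exact h1 2 0
      | exact h1 2 1
      | exact h1 2 2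
      | exact absurd hk (by simp)
  · intro h
    refine Prod.ext ?_ (Prod.ext (h 16 (by simp)) (Prod.ext (h 20 (by simp)) (h 21 (by simp))))
    ext p q
    refine h ⟨4 * p + q, by omega⟩ ?_
    fin_cases p <;> fin_cases q <;> simp

/-- The elements of the kernel have coordinates only in the last row and the last column of either
block. The product of two of them lies in the corners of the blocks, which annihilate the kernel. -/
theorem pow_three_eq_zero_of_mem_ker {x : RatDoubleBurnside SymThree}
    (hx : x ∈ RingHom.ker semisimpleHom) : x * x * x = 0 := by
  rw [mem_ker_semisimpleHom] at hx
  have h0 : coordForm 0 x = 0 := hx 0 (by simp)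
  have h1 : coordForm 1 x = 0 := hx 1 (by simp)
  have h2 : coordForm 2 x = 0 := hx 2 (by simp)
  have h4 : coordForm 4 x = 0 := hx 4 (by simp)
  have h5 : coordForm 5 x = 0 := hx 5 (by simp)
  have h6 : coordForm 6 x = 0 := hx 6 (by simp)
  have h8 : coordForm 8 x = 0 := hx 8 (by simp)
  have h9 : coordForm 9 x = 0 := hx 9 (by simp)
  have h10 : coordForm 10 x = 0 := hx 10 (by simp)
  have h16 : coordForm 16 x = 0 := hx 16 (by simp)
  have h20 : coordForm 20 x = 0 := hx 20 (by simp)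
  have h21 : coordForm 21 x = 0 := hx 21 (by simp)
  refine eq_of_coordForm_eq fun k => ?_
  rw [coordForm_mul' k k.2, map_zero]
  fin_cases k <;>
    simp [prodCoord, coordForm_mul', h0, h1, h2, h4, h5, h6, h8, h9, h10, h16, h20, h21]

theorem jacobson_eq_ker :
    Ring.jacobson (RatDoubleBurnside SymThree) = RingHom.ker semisimpleHom := by
  apply le_antisymm
  · have : RingHomSurjective (semisimpleHom : RatDoubleBurnside SymThree →+*
        Matrix (Fin 3) (Fin 3) ℚ × ℚ × ℚ × ℚ) := ⟨semisimpleHom_surjective⟩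
    refine (Ring.le_comap_jacobson (semisimpleHom : RatDoubleBurnside SymThree →+*
      Matrix (Fin 3) (Fin 3) ℚ × ℚ × ℚ × ℚ)).trans ?_
    rw [IsSemisimpleRing.jacobson_eq_bot]
    exact le_rfl
  · intro x hx
    rw [← Ideal.jacobson_bot, Ideal.mem_jacobson_iff]
    intro y
    have hyx := pow_three_eq_zero_of_mem_ker (Ideal.mul_mem_left _ y hx)
    refine ⟨1 - y * x + y * x * (y * x), ?_⟩
    rw [Ideal.mem_bot, mul_assoc _ y x]
    generalize y * x = n at hyx
    rw [← hyx]
    simp only [add_mul, sub_mul, one_mul]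
    abel

theorem mem_jacobson {x : RatDoubleBurnside SymThree} :
    x ∈ Ring.jacobson (RatDoubleBurnside SymThree) ↔ ∀ k : Fin 22,
      (k : ℕ) + 1 ∉ ({4, 8, 12, 13, 14, 15, 16, 18, 19, 20} : Set ℕ) → coordForm k x = 0 := by
  rw [jacobson_eq_ker, mem_ker_semisimpleHom]

/-- The remaining coordinates as a linear map on the Jacobson radical. -/
noncomputable def jacobsonCoord : Ring.jacobson (RatDoubleBurnside SymThree) →ₗ[ℚ]
    ({i : Fin 22 // (i : ℕ) + 1 ∈ ({4, 8, 12, 13, 14, 15, 16, 18, 19, 20} : Set ℕ)} → ℚ) where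
  toFun x i := coordForm i.1 x.1
  map_add' x y := funext fun i => map_add (coordForm i.1) x.1 y.1
  map_smul' s x := funext fun i => map_smul (coordForm i.1) s x.1

theorem jacobsonCoord_bijective : Function.Bijective jacobsonCoord := by
  classical
  constructor
  · intro x y h
    refine Subtype.ext (eq_of_coordForm_eq fun k => ?_)
    by_cases hk : (k : ℕ) + 1 ∈ ({4, 8, 12, 13, 14, 15, 16, 18, 19, 20} : Set ℕ)
    · exact congrFun h ⟨k, hk⟩
    · rw [mem_jacobson.1 x.2 k hk, mem_jacobson.1 y.2 k hk]
  · intro v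
    refine ⟨⟨coordEquiv.symm fun k => if hk : _ then v ⟨k, hk⟩ else 0,
      mem_jacobson.2 fun k hk => ?_⟩, funext fun i => ?_⟩
    · rw [coordForm_coordEquiv_symm k k.2, dif_neg hk]
    · refine (coordForm_coordEquiv_symm i.1 i.1.2 _).trans ?_
      rw [dif_pos i.2]

theorem exists_basis_jacobson : ∃ B : Module.Basis
    {i : Fin 22 // (i : ℕ) + 1 ∈ ({4, 8, 12, 13, 14, 15, 16, 18, 19, 20} : Set ℕ)} ℚ
      (Ring.jacobson (RatDoubleBurnside SymThree)),
    ∀ i, (B i : RatDoubleBurnside SymThree) = markBasis i := by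
  classical
  refine ⟨.ofEquivFun (LinearEquiv.ofBijective jacobsonCoord jacobsonCoord_bijective), fun i => ?_⟩
  have hi : markBasis i ∈ Ring.jacobson (RatDoubleBurnside SymThree) := by
    refine mem_jacobson.2 fun k hk => ?_
    rw [coordForm_markBasis, if_neg]
    rintro rfl
    exact hk i.2
  suffices h : Module.Basis.ofEquivFun
      (LinearEquiv.ofBijective jacobsonCoord jacobsonCoord_bijective) i = ⟨markBasis i, hi⟩ from
    congrArg Subtype.val h
  rw [Module.Basis.coe_ofEquivFun, LinearEquiv.symm_apply_eq]
  ext k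
  rw [Pi.single_apply]
  refine Eq.trans ?_ (coordForm_markBasis i k).symm
  simp only [Subtype.ext_iff]

theorem mainTheorem11 :
    ∃ b c : Module.Basis (Fin 22) ℚ (RatDoubleBurnside SymThree),
      (∀ i, b i = transitiveClass (symThreePairSub i)) ∧
      (∀ i, b i = ∑ j, modifiedMarks i j • c j) ∧
      (∃ B : Module.Basis
          {i : Fin 22 // (i : ℕ) + 1 ∈ ({4, 8, 12, 13, 14, 15, 16, 18, 19, 20} : Set ℕ)} ℚ
          (Ring.jacobson (RatDoubleBurnside SymThree)),
        ∀ i, (B i : RatDoubleBurnside SymThree) = c i) ∧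
      Nonempty
        ((RatDoubleBurnside SymThree ⧸ Ring.jacobson (RatDoubleBurnside SymThree)) ≃ₐ[ℚ]
          (Matrix (Fin 3) (Fin 3) ℚ × ℚ × ℚ × ℚ)) :=
  ⟨transitiveBasis, markBasis, transitiveBasis_apply, transitiveBasis_eq_sum,
    exists_basis_jacobson,
    ⟨(Ideal.quotientEquivAlgOfEq ℚ jacobson_eq_ker).trans
      (Ideal.quotientKerAlgEquivOfSurjective semisimpleHom_surjective)⟩⟩
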